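/- Let $(M,g)$ be a non-empty compact smooth Riemannian manifold without boundary, of dimension $n\ge 2$, whose sectional curvature is a constant $\kappa>0$. Then $(M,g)$ admits no conformal product structure of rank $1$. Here a \emph{Weyl connection} on $(M,g)$ is a torsion-free linear connection $D$ on $TM$ such that $Dg=-2\theta\otimes g$ for some smooth $1$-form $\theta$ on $M$. A \emph{conformal product structure} on $(M,g)$ is a Weyl connection $D$ together with a decomposition $TM=T_1\oplus T_2$ into $g$-orthogonal, $D$-parallel, non-trivial smooth distributions of constant rank; its \emph{rank} is $\min(\operatorname{rank}T_1,\operatorname{rank}T_2)$. -/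

import Mathlib

open Bundle VectorField
open scoped Manifold ContDiff

section RiemannianGeometry

variable {E : Type*} [NormedAddCommGroup E] [NormedSpace ℝ E] [FiniteDimensional ℝ E]
  {H : Type*} [TopologicalSpace H] (I : ModelWithCorners ℝ E H)
  (M : Type*) [TopologicalSpace M] [ChartedSpace H M] [IsManifold I ∞ M]

/-- A linear connection on (the tangent bundle of) `M`, smooth in the sense that it maps smooth
vector fields to smooth sections of `End(TM)`. For a connection `D`, the value of `D_X Y` at `x` is
`D.cov Y x (X x)`. -/
structure LinearConnection where
  cov : CovariantDerivative I E (fun x : M ↦ TangentSpace I x)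
  smooth : CovariantDerivative.ContMDiffCovariantDerivative cov ∞

variable {I M}

/-- The curvature `R(X, Y) Z = D_X D_Y Z - D_Y D_X Z - D_[X, Y] Z`. -/
noncomputable def LinearConnection.curvature (D : LinearConnection I M)
    (X Y Z : Π x : M, TangentSpace I x) (x : M) : TangentSpace I x :=
  D.cov (fun y ↦ D.cov Z y (Y y)) x (X x) - D.cov (fun y ↦ D.cov Z y (X y)) x (Y x)
    - D.cov Z x (mlieBracket I X Y x)

/-- A smooth distribution of constant rank on `M`, i.e. a smooth subbundle of `TM`: near every
point it has a smooth frame consisting of `rank` vector fields. -/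
structure SmoothDistribution (I : ModelWithCorners ℝ E H)
    (M : Type*) [TopologicalSpace M] [ChartedSpace H M] [IsManifold I ∞ M] where
  space : Π x : M, Submodule ℝ (TangentSpace I x)
  rank : ℕ
  exists_frame : ∀ x : M, ∃ U : Set M, IsOpen U ∧ x ∈ U ∧
    ∃ s : Fin rank → Π y : M, TangentSpace I y,
      (∀ i, CMDiff[U] ∞ (T% (s i))) ∧
      ∀ y ∈ U, LinearIndependent ℝ (fun i ↦ s i y) ∧
        Submodule.span ℝ (Set.range fun i ↦ s i y) = space y

/-- The distribution `T` is `D`-parallel: `D_v Y` belongs to `T`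
for every (local) smooth section `Y` of `T` and every tangent vector `v`. -/
def SmoothDistribution.IsParallel (T : SmoothDistribution I M) (D : LinearConnection I M) : Prop :=
  ∀ (U : Set M) (Y : Π x : M, TangentSpace I x), IsOpen U → CMDiff[U] ∞ (T% Y) →
    (∀ x ∈ U, Y x ∈ T.space x) → ∀ x ∈ U, ∀ v : TangentSpace I x, D.cov Y x v ∈ T.space x

/- From here on `M` carries a smooth Riemannian metric, `inner ℝ` on the tangent spaces. -/
variable [RiemannianBundle (fun x : M ↦ TangentSpace I x)]
  [IsContMDiffRiemannianBundle I ∞ E (fun x : M ↦ TangentSpace I x)]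

/-- `(D_v g)(Y, Z) = v(⟨Y, Z⟩) - ⟨D_v Y, Z⟩ - ⟨Y, D_v Z⟩` for a tangent vector `v` at `x` and
vector fields `Y`, `Z`. -/
noncomputable def LinearConnection.derivMetric (D : LinearConnection I M)
    (Y Z : Π x : M, TangentSpace I x) (x : M) (v : TangentSpace I x) : ℝ :=
  d% (fun y ↦ (inner ℝ (Y y) (Z y) : ℝ)) x v
    - inner ℝ (D.cov Y x v) (Z x) - inner ℝ (Y x) (D.cov Z x v)

/-- `D` is the Levi-Civita connection: it is torsion-free and metric (`D g = 0`). -/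
def LinearConnection.IsLeviCivita (D : LinearConnection I M) : Prop :=
  D.cov.torsion = 0 ∧
    ∀ (x : M) (Y Z : Π x : M, TangentSpace I x), MDiffAt (T% Y) x → MDiffAt (T% Z) x →
      ∀ v : TangentSpace I x, D.derivMetric Y Z x v = 0

/-- `⟨R(X, Y) Y, X⟩ / (|X|² |Y|² - ⟨X, Y⟩²)`. If `D` is the Levi-Civita connection, this
is the sectional curvature of the plane spanned by `X x` and `Y x`
when these are linearly independent. -/
noncomputable def LinearConnection.sectionalCurvature (D : LinearConnection I M)
    (X Y : Π x : M, TangentSpace I x) (x : M) : ℝ :=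
  inner ℝ (D.curvature X Y Y x) (X x) /
    (inner ℝ (X x) (X x) * inner ℝ (Y x) (Y x) - inner ℝ (X x) (Y x) ^ 2)

variable (I M) in
/-- All sectional curvatures of `M`, computed with the Levi-Civita connection, equal `κ`. -/
def HasConstantSectionalCurvature (κ : ℝ) : Prop :=
  ∃ D : LinearConnection I M, D.IsLeviCivita ∧
    ∀ X Y : Π x : M, TangentSpace I x, CMDiff ∞ (T% X) → CMDiff ∞ (T% Y) →
      ∀ x : M, LinearIndependent ℝ ![X x, Y x] → D.sectionalCurvature X Y x = κ

variable (I M) in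
/-- A Weyl connection: a torsion-free linear connection `D` with `D g = -2 θ ⊗ g` for some smooth
1-form `θ`, the Lee form. -/
structure WeylConnection extends LinearConnection I M where
  torsion_eq_zero : cov.torsion = 0
  /-- the Lee form `θ` -/
  leeForm : Π x : M, TangentSpace I x →L[ℝ] ℝ
  contMDiff_leeForm : ContMDiff I (I.prod 𝓘(ℝ, E →L[ℝ] ℝ)) ∞ (fun x : M ↦
    TotalSpace.mk' (E →L[ℝ] ℝ) (E := fun x : M ↦ TangentSpace I x →L[ℝ] Trivial M ℝ x)
      x (leeForm x))
  derivMetric_eq : ∀ (x : M) (Y Z : Π x : M, TangentSpace I x),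
    MDiffAt (T% Y) x → MDiffAt (T% Z) x → ∀ v : TangentSpace I x,
      toLinearConnection.derivMetric Y Z x v = -2 * leeForm x v * inner ℝ (Y x) (Z x)

variable (I M) in
/-- A conformal product structure: a Weyl connection `D` and an orthogonal decomposition
`TM = T₁ ⊕ T₂` into non-trivial `D`-parallel distributions. -/
structure ConformalProductStructure extends WeylConnection I M where
  T₁ : SmoothDistribution I M
  T₂ : SmoothDistribution I M
  isCompl : ∀ x : M, IsCompl (T₁.space x) (T₂.space x)
  orthogonal : ∀ x : M, ∀ u ∈ T₁.space x, ∀ v ∈ T₂.space x, inner ℝ u v = 0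
  nontrivial₁ : 0 < T₁.rank
  nontrivial₂ : 0 < T₂.rank
  parallel₁ : T₁.IsParallel toLinearConnection
  parallel₂ : T₂.IsParallel toLinearConnection

/-- The rank of a conformal product structure is the smaller of the ranks of `T₁` and `T₂`. -/
def ConformalProductStructure.rank (P : ConformalProductStructure I M) : ℕ :=
  min P.T₁.rank P.T₂.rank

end RiemannianGeometry

set_option linter.unusedSectionVars false

section VectorFieldCalculus

open Filter Topology

variable {E : Type*} [NormedAddCommGroup E] [NormedSpace ℝ E] [FiniteDimensional ℝ E]
  {H : Type*} [TopologicalSpace H] {I : ModelWithCorners ℝ E H}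
  {M : Type*} [TopologicalSpace M] [ChartedSpace H M] [IsManifold I ∞ M]
  {X Y Z W : Π x : M, TangentSpace I x} {f : M → ℝ} {p : M}

theorem Filter.EventuallyEq.mvfderiv_eq {g : M → ℝ} (h : f =ᶠ[𝓝 p] g) : d% f p = d% g p := by
  simp only [mvfderiv]
  rw [h.mfderiv_eq]
  rfl

theorem contMDiff_lieDerivative (hf : CMDiff ∞ f) (hX : CMDiff ∞ (T% X)) :
    CMDiff ∞ (fun y ↦ d% f y (X y)) := by
  have h1 : ContMDiff I.tangent 𝓘(ℝ, ℝ).tangent ∞ (tangentMap I 𝓘(ℝ, ℝ) f) :=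
    hf.contMDiff_tangentMap (by simp)
  have h2 := h1.comp hX
  have := contMDiff_snd_tangentBundle_modelSpace ℝ 𝓘(ℝ, ℝ) (n := ∞)
  exact this.comp h2

theorem contMDiff_cov (D : LinearConnection I M) (hX : CMDiff ∞ (T% X)) (hY : CMDiff ∞ (T% Y)) :
    CMDiff ∞ (T% (fun y ↦ D.cov Y y (X y))) := by
  have h := D.smooth.contMDiff.contMDiff (σ := Y) (by simpa using hY.contMDiffOn)
  rw [contMDiffOn_univ] at h
  exact ContMDiff.clm_bundle_apply h hX

theorem contMDiff_mlieBracket (hX : CMDiff ∞ (T% X)) (hY : CMDiff ∞ (T% Y)) :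
    CMDiff ∞ (T% (mlieBracket I X Y)) := by
  have : IsManifold I ((((⊤ : ℕ∞)) : ℕ∞ω) + 1) M := by simpa
  have : IsManifold I (minSmoothness ℝ 2) M := by
    rw [minSmoothness_of_isRCLikeNormedField]; infer_instance
  exact ContDiff.mlieBracket_vectorField (n := ⊤) (m := ⊤) hX hY
    (by simp [minSmoothness_of_isRCLikeNormedField])

theorem ContMDiff.mdiffAt_section (hX : CMDiff ∞ (T% X)) : MDiffAt (T% X) p :=
  hX.mdifferentiableAt (by simp)

theorem ContMDiff.mdiffAt_fun (hf : CMDiff ∞ f) : MDiffAt f p :=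
  hf.mdifferentiableAt (by simp)

theorem mlieBracket_jacobi (hX : CMDiff ∞ (T% X)) (hY : CMDiff ∞ (T% Y)) (hZ : CMDiff ∞ (T% Z)) :
    mlieBracket I X (mlieBracket I Y Z) p =
      mlieBracket I (mlieBracket I X Y) Z p + mlieBracket I Y (mlieBracket I X Z) p := by
  have : IsManifold I (minSmoothness ℝ 3) M := by
    rw [minSmoothness_of_isRCLikeNormedField]; infer_instance
  have h2 : minSmoothness ℝ 2 ≤ ∞ := by
    rw [minSmoothness_of_isRCLikeNormedField]; exact ENat.LEInfty.out
  exact leibniz_identity_mlieBracket_apply ((hX.of_le h2) p) ((hY.of_le h2) p) ((hZ.of_le h2) p)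

theorem lieDerivative_mlieBracket_of_ne_zero (hf : CMDiff ∞ f) (hX : CMDiff ∞ (T% X)) (hY : CMDiff ∞ (T% Y))
    (hZ : CMDiff ∞ (T% Z)) (hp : Z p ≠ 0) :
    d% f p (mlieBracket I X Y p) =
      d% (fun y ↦ d% f y (Y y)) p (X p) - d% (fun y ↦ d% f y (X y)) p (Y p) := by
  have key : ∀ {V : Π x : M, TangentSpace I x} {q : M} {g : M → ℝ} {U : Π x : M, TangentSpace I x},
      CMDiff ∞ g → CMDiff ∞ (T% U) →
      mlieBracket I V (g • U) q = d% g q (V q) • U q + g q • mlieBracket I V U q :=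
    fun hg hU ↦ mlieBracket_smul_right hg.mdiffAt_fun hU.mdiffAt_section
  have jac := mlieBracket_jacobi (p := p) hX hY (hf.smul_section hZ)
  have jac0 := mlieBracket_jacobi (p := p) hX hY hZ
  have e : ∀ {V : Π x : M, TangentSpace I x}, mlieBracket I V (f • Z)
      = (fun q ↦ d% f q (V q)) • Z + f • mlieBracket I V Z := by
    intro V; ext1 q; exact key hf hZ
  have step : ∀ {V V' : Π x : M, TangentSpace I x}, CMDiff ∞ (T% V) → CMDiff ∞ (T% V') →
      mlieBracket I V (mlieBracket I V' (f • Z)) p =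
        (d% (fun q ↦ d% f q (V' q)) p (V p) • Z p + d% f p (V' p) • mlieBracket I V Z p) +
        (d% f p (V p) • mlieBracket I V' Z p + f p • mlieBracket I V (mlieBracket I V' Z) p) := by
    intro V V' hV hV'
    rw [e, mlieBracket_add_right
      ((contMDiff_lieDerivative hf hV').smul_section hZ).mdiffAt_section
      (hf.smul_section (contMDiff_mlieBracket hV' hZ)).mdiffAt_section,
      key (contMDiff_lieDerivative hf hV') hZ, key hf (contMDiff_mlieBracket hV' hZ)]
  rw [step hX hY, step hY hX, key hf hZ, jac0] at jac
  have h : (d% f p (mlieBracket I X Y p) - (d% (fun y ↦ d% f y (Y y)) p (X p)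
      - d% (fun y ↦ d% f y (X y)) p (Y p))) • Z p = 0 := by
    simp only [sub_smul]
    rw [smul_add] at jac
    linear_combination (norm := module) (-1 : ℝ) • jac
  rcases smul_eq_zero.1 h with h | h
  · exact sub_eq_zero.1 h
  · exact absurd h hp

end VectorFieldCalculus

section Extension

open Filter Topology

variable {E : Type*} [NormedAddCommGroup E] [NormedSpace ℝ E] [FiniteDimensional ℝ E]
  {H : Type*} [TopologicalSpace H] {I : ModelWithCorners ℝ E H}
  {M : Type*} [TopologicalSpace M] [ChartedSpace H M] [IsManifold I ∞ M] [T2Space M]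
  {p : M}

theorem exists_contMDiff_eventuallyEq {U : Set M} (hU : IsOpen U) (hp : p ∈ U)
    {s : Π x : M, TangentSpace I x} (hs : CMDiff[U] ∞ (T% s)) :
    ∃ X : Π x : M, TangentSpace I x, CMDiff ∞ (T% X) ∧ ∀ᶠ y in 𝓝 p, X y = s y := by
  obtain ⟨φ, -, hφ⟩ := ((SmoothBumpFunction.nhds_basis_tsupport (I := I) p).mem_iff).1
    (hU.mem_nhds hp)
  refine ⟨(φ : M → ℝ) • s,
    ContMDiffOn.smul_section_of_tsupport φ.contMDiff.contMDiffOn hU hφ hs, ?_⟩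
  filter_upwards [φ.eventuallyEq_one] with y hy
  simp [hy]

theorem exists_contMDiff_apply_eq (v : TangentSpace I p) :
    ∃ X : Π x : M, TangentSpace I x, CMDiff ∞ (T% X) ∧ X p = v := by
  have : IsManifold I (∞ + 1) M := by simpa
  have : ContMDiffVectorBundle ∞ E (TangentSpace I : M → Type _) I :=
    TangentBundle.contMDiffVectorBundle
  obtain ⟨s, hs, h⟩ := FiberBundle.exists_contMDiffOn_extend I E (k := ∞) v
  obtain ⟨t, hts, ht, hpt⟩ := mem_nhds_iff.1 hs
  obtain ⟨X, hX, hXe⟩ := exists_contMDiff_eventuallyEq ht hpt (h.mono hts)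
  exact ⟨X, hX, by simpa using hXe.self_of_nhds⟩

theorem lieDerivative_mlieBracket {X Y : Π x : M, TangentSpace I x} {f : M → ℝ}
    (hf : CMDiff ∞ f) (hX : CMDiff ∞ (T% X)) (hY : CMDiff ∞ (T% Y)) :
    d% f p (mlieBracket I X Y p) =
      d% (fun y ↦ d% f y (Y y)) p (X p) - d% (fun y ↦ d% f y (X y)) p (Y p) := by
  by_cases h : ∃ v : TangentSpace I p, v ≠ 0
  · obtain ⟨v, hv⟩ := h
    obtain ⟨Z, hZ, rfl⟩ := exists_contMDiff_apply_eq v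
    exact lieDerivative_mlieBracket_of_ne_zero hf hX hY hZ hv
  · push Not at h
    rw [h (mlieBracket I X Y p), h (X p), h (Y p)]
    simp

end Extension

section Curvature

open Filter Topology

variable {E : Type*} [NormedAddCommGroup E] [NormedSpace ℝ E] [FiniteDimensional ℝ E]
  {H : Type*} [TopologicalSpace H] {I : ModelWithCorners ℝ E H}
  {M : Type*} [TopologicalSpace M] [ChartedSpace H M] [IsManifold I ∞ M] [T2Space M]
  {X X' Y Z W : Π x : M, TangentSpace I x} {f : M → ℝ} {p : M}
  {D : LinearConnection I M}

theorem LinearConnection.cov_add (D : LinearConnection I M) (hX : CMDiff ∞ (T% X))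
    (hY : CMDiff ∞ (T% Y)) : D.cov (X + Y) p = D.cov X p + D.cov Y p :=
  D.cov.isCovariantDerivativeOnUniv.add hX.mdiffAt_section hY.mdiffAt_section

theorem LinearConnection.cov_sub (D : LinearConnection I M) (hX : CMDiff ∞ (T% X))
    (hY : CMDiff ∞ (T% Y)) : D.cov (X - Y) p = D.cov X p - D.cov Y p := by
  have := D.cov_add (p := p) (hX.sub_section hY) hY
  rw [sub_add_cancel] at this
  rw [this, add_sub_cancel_right]

theorem LinearConnection.cov_smul (D : LinearConnection I M) (hf : CMDiff ∞ f)
    (hX : CMDiff ∞ (T% X)) (v : TangentSpace I p) :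
    D.cov (f • X) p v = f p • D.cov X p v + d% f p v • X p := by
  rw [D.cov.isCovariantDerivativeOnUniv.leibniz hX.mdiffAt_section hf.mdiffAt_fun]
  rfl

theorem LinearConnection.cov_congr (D : LinearConnection I M) (hX : CMDiff ∞ (T% X))
    (hY : CMDiff ∞ (T% Y)) (h : ∀ᶠ y in 𝓝 p, X y = Y y) : D.cov X p = D.cov Y p :=
  D.cov.isCovariantDerivativeOnUniv.congr_of_eventuallyEq hX.mdiffAt_section hY.mdiffAt_section
    univ_mem h

theorem LinearConnection.torsionFree_apply (hD : D.cov.torsion = 0) (hX : CMDiff ∞ (T% X))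
    (hY : CMDiff ∞ (T% Y)) :
    D.cov Y p (X p) - D.cov X p (Y p) = mlieBracket I X Y p :=
  (D.cov.torsion_eq_zero_iff.1 hD) hX.mdiffAt_section hY.mdiffAt_section

theorem LinearConnection.curvature_swap (D : LinearConnection I M) :
    D.curvature X Y Z p = - D.curvature Y X Z p := by
  simp only [LinearConnection.curvature]
  rw [mlieBracket_swap_apply]
  simp only [map_neg]
  abel

theorem LinearConnection.curvature_add_left (D : LinearConnection I M) (hX : CMDiff ∞ (T% X))
    (hX' : CMDiff ∞ (T% X')) (hZ : CMDiff ∞ (T% Z)) :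
    D.curvature (X + X') Y Z p = D.curvature X Y Z p + D.curvature X' Y Z p := by
  simp only [LinearConnection.curvature]
  have h : (fun y ↦ D.cov Z y ((X + X') y))
      = (fun y ↦ D.cov Z y (X y)) + (fun y ↦ D.cov Z y (X' y)) := by
    ext1 y; simp
  rw [h, D.cov_add (contMDiff_cov D hX hZ) (contMDiff_cov D hX' hZ),
    mlieBracket_add_left hX.mdiffAt_section hX'.mdiffAt_section]
  simp only [Pi.add_apply, map_add, add_apply]
  abel

theorem LinearConnection.bianchi (hD : D.cov.torsion = 0) (hX : CMDiff ∞ (T% X))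
    (hY : CMDiff ∞ (T% Y)) (hZ : CMDiff ∞ (T% Z)) :
    D.curvature X Y Z p + D.curvature Y Z X p + D.curvature Z X Y p = 0 := by
  have key : ∀ {X Y Z : Π x : M, TangentSpace I x}, CMDiff ∞ (T% X) → CMDiff ∞ (T% Y) →
      CMDiff ∞ (T% Z) →
      D.cov (fun y ↦ D.cov Z y (Y y)) p (X p) - D.cov (fun y ↦ D.cov Y y (Z y)) p (X p)
        = D.cov X p (mlieBracket I Y Z p) + mlieBracket I X (mlieBracket I Y Z) p := by
    intro X Y Z hX hY hZ
    have h : (fun y ↦ D.cov Z y (Y y)) - (fun y ↦ D.cov Y y (Z y)) = mlieBracket I Y Z := by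
      ext1 y; exact LinearConnection.torsionFree_apply hD hY hZ
    have h2 := D.cov_sub (p := p) (contMDiff_cov D hY hZ) (contMDiff_cov D hZ hY)
    rw [h] at h2
    have h3 := congrArg (fun L ↦ L (X p)) h2
    simp only [sub_apply] at h3
    rw [← h3, ← LinearConnection.torsionFree_apply hD hX (contMDiff_mlieBracket hY hZ)]
    abel
  have k1 := key hX hY hZ
  have k2 := key hY hZ hX
  have k3 := key hZ hX hY
  have jac := mlieBracket_jacobi (p := p) hX hY hZ
  rw [mlieBracket_swap_apply (V := mlieBracket I X Y)] at jac
  have e : mlieBracket I Y (mlieBracket I Z X) p = - mlieBracket I Y (mlieBracket I X Z) p := by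
    rw [mlieBracket_swap (V := Z), ← neg_one_smul ℝ,
      mlieBracket_const_smul_right (contMDiff_mlieBracket hX hZ).mdiffAt_section, neg_one_smul]
  rw [e] at k2
  simp only [LinearConnection.curvature]
  linear_combination (norm := module) (1 : ℝ) • k1 + (1 : ℝ) • k2 + (1 : ℝ) • k3 + (1 : ℝ) • jac

variable [RiemannianBundle (fun x : M ↦ TangentSpace I x)]
  [IsContMDiffRiemannianBundle I ∞ E (fun x : M ↦ TangentSpace I x)]

theorem contMDiff_inner (hX : CMDiff ∞ (T% X)) (hY : CMDiff ∞ (T% Y)) :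
    CMDiff ∞ (fun y ↦ (inner ℝ (X y) (Y y) : ℝ)) :=
  ContMDiff.inner_bundle hX hY

theorem LinearConnection.IsLeviCivita.lieDerivative_inner (hD : D.IsLeviCivita)
    (hY : CMDiff ∞ (T% Y)) (hZ : CMDiff ∞ (T% Z)) (v : TangentSpace I p) :
    d% (fun y ↦ (inner ℝ (Y y) (Z y) : ℝ)) p v
      = inner ℝ (D.cov Y p v) (Z p) + inner ℝ (Y p) (D.cov Z p v) := by
  have := hD.2 p Y Z hY.mdiffAt_section hZ.mdiffAt_section v
  rw [LinearConnection.derivMetric] at this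
  linarith

theorem LinearConnection.IsLeviCivita.curvature_skew (hD : D.IsLeviCivita)
    (hX : CMDiff ∞ (T% X)) (hY : CMDiff ∞ (T% Y)) (hZ : CMDiff ∞ (T% Z)) (hW : CMDiff ∞ (T% W)) :
    inner ℝ (D.curvature X Y Z p) (W p) = - inner ℝ (D.curvature X Y W p) (Z p) := by
  have h := lieDerivative_mlieBracket (p := p) (contMDiff_inner hZ hW) hX hY
  have e : ∀ {X Y : Π x : M, TangentSpace I x}, CMDiff ∞ (T% X) → CMDiff ∞ (T% Y) →
      d% (fun y ↦ d% (fun y ↦ (inner ℝ (Z y) (W y) : ℝ)) y (Y y)) p (X p) =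
      (inner ℝ (D.cov (fun y ↦ D.cov Z y (Y y)) p (X p)) (W p)
        + inner ℝ (D.cov Z p (Y p)) (D.cov W p (X p)))
      + (inner ℝ (D.cov Z p (X p)) (D.cov W p (Y p))
        + inner ℝ (Z p) (D.cov (fun y ↦ D.cov W y (Y y)) p (X p))) := by
    intro X Y hX hY
    simp_rw [hD.lieDerivative_inner hZ hW]
    rw [mvfderiv_fun_add (contMDiff_inner (contMDiff_cov D hY hZ) hW).mdiffAt_fun
      (contMDiff_inner hZ (contMDiff_cov D hY hW)).mdiffAt_fun, add_apply,
      hD.lieDerivative_inner (contMDiff_cov D hY hZ) hW,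
      hD.lieDerivative_inner hZ (contMDiff_cov D hY hW)]
  rw [e hX hY, e hY hX, hD.lieDerivative_inner hZ hW] at h
  simp only [LinearConnection.curvature, inner_sub_left]
  rw [real_inner_comm (D.cov (fun y ↦ D.cov W y (Y y)) p (X p)),
    real_inner_comm (D.cov (fun y ↦ D.cov W y (X y)) p (Y p)),
    real_inner_comm (D.cov W p (mlieBracket I X Y p))] at *
  linarith

theorem LinearConnection.IsLeviCivita.curvature_pair_symm (hD : D.IsLeviCivita)
    (hX : CMDiff ∞ (T% X)) (hY : CMDiff ∞ (T% Y)) (hZ : CMDiff ∞ (T% Z)) (hW : CMDiff ∞ (T% W)) :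
    inner ℝ (D.curvature X Y Z p) (W p) = inner ℝ (D.curvature Z W X p) (Y p) := by
  have b : ∀ {X Y Z : Π x : M, TangentSpace I x} (W : Π x : M, TangentSpace I x),
      CMDiff ∞ (T% X) → CMDiff ∞ (T% Y) → CMDiff ∞ (T% Z) →
      inner ℝ (D.curvature X Y Z p) (W p) + inner ℝ (D.curvature Y Z X p) (W p)
        + inner ℝ (D.curvature Z X Y p) (W p) = 0 := by
    intro X Y Z W hX hY hZ
    rw [← inner_add_left, ← inner_add_left, LinearConnection.bianchi hD.1 hX hY hZ, inner_zero_left]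
  have sw : ∀ (X Y Z W : Π x : M, TangentSpace I x),
      inner ℝ (D.curvature X Y Z p) (W p) = - inner ℝ (D.curvature Y X Z p) (W p) := by
    intro X Y Z W
    rw [D.curvature_swap, inner_neg_left]
  have b1 := b W hX hY hZ
  have b2 := b X hY hZ hW
  have b3 := b Y hZ hW hX
  have b4 := b Z hW hX hY
  have s1 := hD.curvature_skew (p := p) hX hY hZ hW
  have s2 := hD.curvature_skew (p := p) hY hZ hX hW
  have s3 := hD.curvature_skew (p := p) hZ hX hY hW
  have s4 := hD.curvature_skew (p := p) hW hX hY hZ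
  have s5 := hD.curvature_skew (p := p) hY hW hX hZ
  have s6 := hD.curvature_skew (p := p) hZ hW hX hY
  linarith [sw X Y Z W, sw X Y W Z, sw Y Z X W, sw Y Z W X, sw Z X Y W, sw Z X W Y, sw W X Y Z,
    sw W X Z Y, sw Y W X Z, sw Y W Z X, sw Z W X Y, sw Z W Y X]

/-- All sectional curvatures computed with `D` equal `κ`, without division. -/
theorem LinearConnection.inner_curvature_of_sectionalCurvature_eq {κ : ℝ}
    (h : ∀ X Y : Π x : M, TangentSpace I x, CMDiff ∞ (T% X) → CMDiff ∞ (T% Y) →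
      ∀ x : M, LinearIndependent ℝ ![X x, Y x] → D.sectionalCurvature X Y x = κ)
    (hX : CMDiff ∞ (T% X)) (hY : CMDiff ∞ (T% Y)) (hXp : X p ≠ 0) (hYp : Y p ≠ 0)
    (hXY : (inner ℝ (X p) (Y p) : ℝ) = 0) :
    inner ℝ (D.curvature X Y Y p) (X p) = κ * (inner ℝ (X p) (X p) * inner ℝ (Y p) (Y p)) := by
  have hli : LinearIndependent ℝ ![X p, Y p] := by
    apply linearIndependent_of_ne_zero_of_inner_eq_zero
    · intro i; fin_cases i <;> simpa
    · intro i j hij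
      fin_cases i <;> fin_cases j <;> simp_all [real_inner_comm]
  have h1 := h X Y hX hY p hli
  rw [LinearConnection.sectionalCurvature, hXY] at h1
  have h2 : (inner ℝ (X p) (X p) * inner ℝ (Y p) (Y p) : ℝ) ≠ 0 :=
    mul_ne_zero (inner_self_ne_zero.2 hXp) (inner_self_ne_zero.2 hYp)
  rwa [zero_pow two_ne_zero, sub_zero, div_eq_iff h2] at h1

/-- The Codazzi-type vanishing of the mixed curvature components. -/
theorem LinearConnection.IsLeviCivita.inner_curvature_eq_zero {κ : ℝ} (hD : D.IsLeviCivita)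
    (h : ∀ X Y : Π x : M, TangentSpace I x, CMDiff ∞ (T% X) → CMDiff ∞ (T% Y) →
      ∀ x : M, LinearIndependent ℝ ![X x, Y x] → D.sectionalCurvature X Y x = κ)
    (hX : CMDiff ∞ (T% X)) (hY : CMDiff ∞ (T% Y)) (hZ : CMDiff ∞ (T% Z))
    (hXp : X p ≠ 0) (hYp : Y p ≠ 0) (hZp : Z p ≠ 0)
    (hXY : (inner ℝ (X p) (Y p) : ℝ) = 0) (hXZ : (inner ℝ (X p) (Z p) : ℝ) = 0)
    (hYZ : (inner ℝ (Y p) (Z p) : ℝ) = 0) :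
    inner ℝ (D.curvature X Y Z p) (Y p) = 0 := by
  have hZX : (inner ℝ (Z p) (X p) : ℝ) = 0 := by rw [real_inner_comm]; exact hXZ
  have hne : (X + Z) p ≠ 0 := by
    intro h0
    have : (inner ℝ ((X + Z) p) (X p) : ℝ) = 0 := by rw [h0, inner_zero_left]
    rw [Pi.add_apply, inner_add_left, hZX, add_zero] at this
    exact hXp (inner_self_eq_zero.1 this)
  have hs : (inner ℝ ((X + Z) p) (Y p) : ℝ) = 0 := by
    rw [Pi.add_apply, inner_add_left, hXY, real_inner_comm, hYZ, add_zero]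
  have h1 := D.inner_curvature_of_sectionalCurvature_eq h (hX.add_section hZ) hY hne hYp hs
  have h2 := D.inner_curvature_of_sectionalCurvature_eq h hX hY hXp hYp hXY
  have h3 := D.inner_curvature_of_sectionalCurvature_eq h hZ hY hZp hYp
    (by rw [real_inner_comm]; exact hYZ)
  rw [D.curvature_add_left hX hZ hY] at h1
  simp only [Pi.add_apply, inner_add_left, inner_add_right, hXZ, hZX] at h1
  have h4 := hD.curvature_pair_symm (p := p) hX hY hY hZ
  have h5 := hD.curvature_skew (p := p) hX hY hY hZ
  have h6 : (inner ℝ (D.curvature Y Z X p) (Y p) : ℝ) = inner ℝ (D.curvature Z Y Y p) (X p) := by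
    rw [hD.curvature_skew hY hZ hX hY, D.curvature_swap, inner_neg_left, neg_neg]
  linarith

end Curvature

section UmbilicNormal

open Filter Topology

variable {E : Type*} [NormedAddCommGroup E] [NormedSpace ℝ E] [FiniteDimensional ℝ E]
  {H : Type*} [TopologicalSpace H] {I : ModelWithCorners ℝ E H}
  {M : Type*} [TopologicalSpace M] [ChartedSpace H M] [IsManifold I ∞ M] [T2Space M]
  [RiemannianBundle (fun x : M ↦ TangentSpace I x)]
  [IsContMDiffRiemannianBundle I ∞ E (fun x : M ↦ TangentSpace I x)]
  {X Y Z A ξ : Π x : M, TangentSpace I x} {p q : M}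
  {D : LinearConnection I M}

/-- `ξ` is a unit vector at `q` and `D_v ξ = ⟨v, ξ⟩ A - ⟨A, ξ⟩ v` for all tangent vectors `v` at
`q`. In an open set, this says that `ξ` is normal to an umbilical foliation. -/
structure IsUmbilicNormalAt (D : LinearConnection I M) (A ξ : Π x : M, TangentSpace I x)
    (q : M) : Prop where
  inner_self : (inner ℝ (ξ q) (ξ q) : ℝ) = 1
  cov_eq : ∀ v : TangentSpace I q,
    D.cov ξ q v = (inner ℝ v (ξ q) : ℝ) • A q - (inner ℝ (A q) (ξ q) : ℝ) • v

theorem IsUmbilicNormalAt.ne_zero (h : IsUmbilicNormalAt D A ξ q) : ξ q ≠ 0 := by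
  intro h0
  simpa [h0] using h.inner_self

theorem IsUmbilicNormalAt.lieDerivative_inner (h : IsUmbilicNormalAt D A ξ q)
    (hD : D.IsLeviCivita) (hA : CMDiff ∞ (T% A)) (hξ : CMDiff ∞ (T% ξ)) (v : TangentSpace I q) :
    d% (fun y ↦ (inner ℝ (A y) (ξ y) : ℝ)) q v = inner ℝ (D.cov A q v) (ξ q)
      + inner ℝ v (ξ q) * inner ℝ (A q) (A q) - inner ℝ (A q) (ξ q) * inner ℝ (A q) v := by
  rw [hD.lieDerivative_inner hA hξ, h.cov_eq, inner_sub_right, inner_smul_right, inner_smul_right]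
  ring

theorem curvature_umbilicNormal (hD : D.IsLeviCivita) (hA : CMDiff ∞ (T% A))
    (hξ : CMDiff ∞ (T% ξ)) (h : ∀ᶠ y in 𝓝 q, IsUmbilicNormalAt D A ξ y)
    (hX : CMDiff ∞ (T% X)) (hY : CMDiff ∞ (T% Y)) :
    D.curvature X Y ξ q =
      ((inner ℝ (X q) (ξ q) * inner ℝ (A q) (Y q) - inner ℝ (Y q) (ξ q) * inner ℝ (A q) (X q) : ℝ))
        • A q + (inner ℝ (Y q) (ξ q) : ℝ) • D.cov A q (X q)
        - (inner ℝ (X q) (ξ q) : ℝ) • D.cov A q (Y q)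
        - d% (fun y ↦ (inner ℝ (A y) (ξ y) : ℝ)) q (X q) • Y q
        + d% (fun y ↦ (inner ℝ (A y) (ξ y) : ℝ)) q (Y q) • X q := by
  have hq := h.self_of_nhds
  have key : ∀ {X Y : Π x : M, TangentSpace I x}, CMDiff ∞ (T% X) → CMDiff ∞ (T% Y) →
      D.cov (fun y ↦ D.cov ξ y (Y y)) q (X q) =
        (inner ℝ (Y q) (ξ q) : ℝ) • D.cov A q (X q)
        + (inner ℝ (D.cov Y q (X q)) (ξ q) + (inner ℝ (X q) (ξ q) * inner ℝ (A q) (Y q)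
          - inner ℝ (A q) (ξ q) * inner ℝ (X q) (Y q)) : ℝ) • A q
        - ((inner ℝ (A q) (ξ q) : ℝ) • D.cov Y q (X q)
        + d% (fun y ↦ (inner ℝ (A y) (ξ y) : ℝ)) q (X q) • Y q) := by
    intro X Y hX hY
    have e : ∀ᶠ y in 𝓝 q, D.cov ξ y (Y y) =
        ((fun y ↦ (inner ℝ (Y y) (ξ y) : ℝ)) • A - (fun y ↦ (inner ℝ (A y) (ξ y) : ℝ)) • Y) y := by
      filter_upwards [h] with y hy
      rw [hy.cov_eq]; rfl
    rw [D.cov_congr (contMDiff_cov D hY hξ) (((contMDiff_inner hY hξ).smul_section hA).sub_section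
      ((contMDiff_inner hA hξ).smul_section hY)) e,
      D.cov_sub ((contMDiff_inner hY hξ).smul_section hA) ((contMDiff_inner hA hξ).smul_section hY),
      sub_apply, D.cov_smul (contMDiff_inner hY hξ) hA, D.cov_smul (contMDiff_inner hA hξ) hY,
      hD.lieDerivative_inner hY hξ, hq.cov_eq, inner_sub_right, inner_smul_right, inner_smul_right,
      real_inner_comm (A q) (Y q), real_inner_comm (X q) (Y q)]
  rw [LinearConnection.curvature, key hX hY, key hY hX, hq.cov_eq,
    ← LinearConnection.torsionFree_apply hD.1 hX hY, inner_sub_left, real_inner_comm (X q) (Y q)]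
  module

variable {κ : ℝ}

/-- The Riccati equation for the normal of an umbilical foliation. -/
theorem inner_cov_umbilicNormal (hD : D.IsLeviCivita)
    (hκ : ∀ X Y : Π x : M, TangentSpace I x, CMDiff ∞ (T% X) → CMDiff ∞ (T% Y) →
      ∀ x : M, LinearIndependent ℝ ![X x, Y x] → D.sectionalCurvature X Y x = κ)
    (hA : CMDiff ∞ (T% A)) (hξ : CMDiff ∞ (T% ξ)) (h : ∀ᶠ y in 𝓝 q, IsUmbilicNormalAt D A ξ y)
    {v : TangentSpace I q} (hv : (inner ℝ v (ξ q) : ℝ) = 0) :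
    (inner ℝ (D.cov A q v) v : ℝ) = (κ - d% (fun y ↦ (inner ℝ (A y) (ξ y) : ℝ)) q (ξ q))
      * inner ℝ v v + inner ℝ (A q) v ^ 2 := by
  by_cases h0 : v = 0
  · simp [h0]
  obtain ⟨X, hX, rfl⟩ := exists_contMDiff_apply_eq v
  have hq := h.self_of_nhds
  have h1 := D.inner_curvature_of_sectionalCurvature_eq hκ hX hξ h0 hq.ne_zero hv
  rw [curvature_umbilicNormal hD hA hξ h hX hξ, hq.inner_self, hv] at h1
  simp only [inner_add_left, inner_sub_left, inner_smul_left, real_inner_comm (X q) (ξ q),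
    hv, RCLike.conj_to_real] at h1
  linarith

/-- The Codazzi equation: the mean curvature of an umbilical foliation is constant along the
leaves, if these have dimension at least two. -/
theorem lieDerivative_umbilicNormal_eq_zero (hD : D.IsLeviCivita)
    (hκ : ∀ X Y : Π x : M, TangentSpace I x, CMDiff ∞ (T% X) → CMDiff ∞ (T% Y) →
      ∀ x : M, LinearIndependent ℝ ![X x, Y x] → D.sectionalCurvature X Y x = κ)
    (hn : 3 ≤ Module.finrank ℝ E)
    (hA : CMDiff ∞ (T% A)) (hξ : CMDiff ∞ (T% ξ)) (h : ∀ᶠ y in 𝓝 q, IsUmbilicNormalAt D A ξ y)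
    {v : TangentSpace I q} (hv : (inner ℝ v (ξ q) : ℝ) = 0) :
    d% (fun y ↦ (inner ℝ (A y) (ξ y) : ℝ)) q v = 0 := by
  by_cases h0 : v = 0
  · simp [h0]
  have hq := h.self_of_nhds
  obtain ⟨u, hu0, huv, huξ⟩ : ∃ u : TangentSpace I q, u ≠ 0 ∧ (inner ℝ v u : ℝ) = 0 ∧
      (inner ℝ u (ξ q) : ℝ) = 0 := by
    have : FiniteDimensional ℝ (TangentSpace I q) := inferInstanceAs (FiniteDimensional ℝ E)
    have hfr : Module.finrank ℝ (TangentSpace I q) = Module.finrank ℝ E := rfl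
    let φ : TangentSpace I q →ₗ[ℝ] (Fin 2 → ℝ) :=
      LinearMap.pi ![(innerₛₗ ℝ v), (innerₛₗ ℝ (ξ q))]
    have hker : LinearMap.ker φ ≠ ⊥ := by
      apply LinearMap.ker_ne_bot_of_finrank_lt
      simp only [Module.finrank_fin_fun]
      omega
    obtain ⟨u, hu, hu0⟩ := (Submodule.ne_bot_iff _).1 hker
    rw [LinearMap.mem_ker] at hu
    refine ⟨u, hu0, ?_, ?_⟩
    · simpa [φ] using congrFun hu 0
    · rw [real_inner_comm]; simpa [φ] using congrFun hu 1
  obtain ⟨X, hX, rfl⟩ := exists_contMDiff_apply_eq v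
  obtain ⟨Y, hY, rfl⟩ := exists_contMDiff_apply_eq u
  have h1 := hD.inner_curvature_eq_zero hκ hX hY hξ h0 hu0 hq.ne_zero huv hv huξ
  rw [curvature_umbilicNormal hD hA hξ h hX hY, hv, huξ] at h1
  simp only [inner_add_left, inner_sub_left, inner_smul_left, huv, RCLike.conj_to_real] at h1
  have h2 : (inner ℝ (Y q) (Y q) : ℝ) ≠ 0 := inner_self_ne_zero.2 hu0
  have h3 : d% (fun y ↦ (inner ℝ (A y) (ξ y) : ℝ)) q (X q) * inner ℝ (Y q) (Y q) = 0 := by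
    linarith
  exact (mul_eq_zero.1 h3).resolve_right h2

end UmbilicNormal

section WeylConnection

open Filter Topology

variable {E : Type*} [NormedAddCommGroup E] [NormedSpace ℝ E] [FiniteDimensional ℝ E]
  {H : Type*} [TopologicalSpace H] {I : ModelWithCorners ℝ E H}
  {M : Type*} [TopologicalSpace M] [ChartedSpace H M] [IsManifold I ∞ M] [T2Space M]
  [RiemannianBundle (fun x : M ↦ TangentSpace I x)]
  [IsContMDiffRiemannianBundle I ∞ E (fun x : M ↦ TangentSpace I x)]
  {X Y Z A ξ : Π x : M, TangentSpace I x} {p q : M}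
  {D : LinearConnection I M}

theorem WeylConnection.inner_cov_sub_cov (W : WeylConnection I M) (hD : D.IsLeviCivita)
    (hX : CMDiff ∞ (T% X)) (hY : CMDiff ∞ (T% Y)) (hZ : CMDiff ∞ (T% Z)) :
    (inner ℝ (W.cov Y q (X q)) (Z q) - inner ℝ (D.cov Y q (X q)) (Z q) : ℝ) =
      W.leeForm q (X q) * inner ℝ (Y q) (Z q) + W.leeForm q (Y q) * inner ℝ (X q) (Z q)
        - W.leeForm q (Z q) * inner ℝ (X q) (Y q) := by
  have m : ∀ {X Y Z : Π x : M, TangentSpace I x}, CMDiff ∞ (T% X) → CMDiff ∞ (T% Y) →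
      CMDiff ∞ (T% Z) →
      (inner ℝ (W.cov Y q (X q)) (Z q) + inner ℝ (W.cov Z q (X q)) (Y q) : ℝ)
        - (inner ℝ (D.cov Y q (X q)) (Z q) + inner ℝ (D.cov Z q (X q)) (Y q))
        = 2 * W.leeForm q (X q) * inner ℝ (Y q) (Z q) := by
    intro X Y Z hX hY hZ
    have h1 := W.derivMetric_eq q Y Z hY.mdiffAt_section hZ.mdiffAt_section (X q)
    rw [LinearConnection.derivMetric, hD.lieDerivative_inner hY hZ] at h1
    rw [real_inner_comm (Y q), real_inner_comm (Y q)]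
    linarith
  have t : ∀ {X Y Z : Π x : M, TangentSpace I x}, CMDiff ∞ (T% X) → CMDiff ∞ (T% Y) →
      CMDiff ∞ (T% Z) →
      (inner ℝ (W.cov Y q (X q)) (Z q) - inner ℝ (W.cov X q (Y q)) (Z q) : ℝ)
        = inner ℝ (D.cov Y q (X q)) (Z q) - inner ℝ (D.cov X q (Y q)) (Z q) := by
    intro X Y Z hX hY hZ
    rw [← inner_sub_left, ← inner_sub_left, LinearConnection.torsionFree_apply hD.1 hX hY,
      ← LinearConnection.torsionFree_apply W.torsion_eq_zero hX hY]
  have m1 := m hX hY hZ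
  have m2 := m hY hX hZ
  have m3 := m hZ hX hY
  have t1 := t hX hY hZ
  have t2 := t hX hZ hY
  have t3 := t hY hZ hX
  linarith

/-- If the line spanned by a unit field `ξ` is parallel for a Weyl connection, the Levi-Civita
derivative of `ξ` is determined by the Lee form. -/
theorem WeylConnection.inner_cov_of_mem_span (W : WeylConnection I M) (hD : D.IsLeviCivita)
    (hξ : CMDiff ∞ (T% ξ)) (h1 : ∀ᶠ y in 𝓝 q, (inner ℝ (ξ y) (ξ y) : ℝ) = 1)
    (hW : ∀ v, W.cov ξ q v ∈ Submodule.span ℝ {ξ q}) (v w : TangentSpace I q) :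
    (inner ℝ (D.cov ξ q v) w : ℝ) =
      inner ℝ v (ξ q) * W.leeForm q w - W.leeForm q (ξ q) * inner ℝ v w := by
  obtain ⟨X, hX, rfl⟩ := exists_contMDiff_apply_eq v
  obtain ⟨Z, hZ, rfl⟩ := exists_contMDiff_apply_eq w
  obtain ⟨c, hc⟩ := Submodule.mem_span_singleton.1 (hW (X q))
  have hn : (inner ℝ (D.cov ξ q (X q)) (ξ q) : ℝ) = 0 := by
    have h2 := hD.lieDerivative_inner hξ hξ (X q)
    have h3 : d% (fun y ↦ (inner ℝ (ξ y) (ξ y) : ℝ)) q = 0 := by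
      have h5 : (fun y ↦ (inner ℝ (ξ y) (ξ y) : ℝ)) =ᶠ[𝓝 q] (fun _ : M ↦ (1 : ℝ)) := h1
      rw [h5.mvfderiv_eq, mvfderiv_const]
    rw [h3, zero_apply, real_inner_comm (D.cov ξ q (X q))] at h2
    linarith
  have k1 := W.inner_cov_sub_cov (q := q) hD hX hξ hξ
  have k2 := W.inner_cov_sub_cov (q := q) hD hX hξ hZ
  rw [← hc, hn, inner_smul_left, h1.self_of_nhds] at k1
  rw [← hc, inner_smul_left] at k2
  simp only [RCLike.conj_to_real] at k1 k2
  have hcv : c = W.leeForm q (X q) := by linarith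
  rw [hcv] at k2
  linarith

/-- A smooth line field is locally spanned by a smooth unit field. -/
theorem SmoothDistribution.exists_unit_field (T : SmoothDistribution I M) (hT : T.rank = 1)
    (p : M) : ∃ ξ : Π x : M, TangentSpace I x, CMDiff ∞ (T% ξ) ∧
      ∀ᶠ y in 𝓝 p, (inner ℝ (ξ y) (ξ y) : ℝ) = 1 ∧ T.space y = Submodule.span ℝ {ξ y} := by
  obtain ⟨U, hU, hp, s, hs, hli⟩ := T.exists_frame p
  obtain ⟨i, hi⟩ : ∃ i : Fin T.rank, ∀ j, j = i :=
    ⟨⟨0, by omega⟩, fun j ↦ Fin.ext (by have := j.2; simp; omega)⟩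
  have hne : ∀ y ∈ U, (0 : ℝ) < inner ℝ (s i y) (s i y) := fun y hy ↦
    real_inner_self_pos.2 ((hli y hy).1.ne_zero i)
  have hspan : ∀ y ∈ U, T.space y = Submodule.span ℝ {s i y} := by
    intro y hy
    rw [← (hli y hy).2]
    congr 1
    ext v
    constructor
    · rintro ⟨j, rfl⟩; rw [hi j]; rfl
    · rintro rfl; exact ⟨i, rfl⟩
  have hin : CMDiff[U] ∞ (fun y ↦ (inner ℝ (s i y) (s i y) : ℝ)) :=
    ContMDiffOn.inner_bundle (hs i) (hs i)
  have hg : CMDiff[U] ∞ (fun y ↦ (√(inner ℝ (s i y) (s i y) : ℝ))⁻¹) := by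
    intro y hy
    have h1 : ContDiffAt ℝ ∞ (fun t : ℝ ↦ (√t)⁻¹) (inner ℝ (s i y) (s i y) : ℝ) :=
      (Real.contDiffAt_sqrt (hne y hy).ne').inv (Real.sqrt_pos.2 (hne y hy)).ne'
    exact ContMDiffAt.comp_contMDiffWithinAt (g := fun t : ℝ ↦ (√t)⁻¹) y h1.contMDiffAt (hin y hy)
  obtain ⟨ξ, hξ, he⟩ := exists_contMDiff_eventuallyEq hU hp (hg.smul_section (hs i))
  refine ⟨ξ, hξ, ?_⟩
  filter_upwards [he, hU.mem_nhds hp] with y hy hyU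
  have hpos := Real.sqrt_pos.2 (hne y hyU)
  rw [hy, hspan y hyU]
  constructor
  · simp only [Pi.smul_apply', inner_smul_left, inner_smul_right, RCLike.conj_to_real]
    field_simp
    exact (Real.sq_sqrt (hne y hyU).le).symm
  · simp only [Pi.smul_apply']
    exact (Submodule.span_singleton_smul_eq (IsUnit.mk0 _ (inv_ne_zero hpos.ne')) _).symm

/-- The field dual to the Lee form of a Weyl connection preserving a line field. -/
theorem WeylConnection.exists_umbilicNormal (W : WeylConnection I M) (hD : D.IsLeviCivita)
    (T : SmoothDistribution I M) (hT : T.rank = 1) (hp : T.IsParallel W.toLinearConnection) :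
    ∃ A : Π x : M, TangentSpace I x, CMDiff ∞ (T% A) ∧ ∀ p, ∃ ξ : Π x : M, TangentSpace I x,
      CMDiff ∞ (T% ξ) ∧ ∀ᶠ y in 𝓝 p, IsUmbilicNormalAt D A ξ y ∧
        T.space y = Submodule.span ℝ {ξ y} := by
  choose ξ hξ hξT using T.exists_unit_field hT
  have hmem : ∀ p, ∀ᶠ q in 𝓝 p, ∀ v, W.cov (ξ p) q v ∈ Submodule.span ℝ {ξ p q} := by
    intro p
    obtain ⟨U, hUs, hU, hpU⟩ := mem_nhds_iff.1 (hξT p)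
    filter_upwards [hU.mem_nhds hpU] with q hq v
    rw [← (hUs hq).2]
    refine hp U (ξ p) hU (hξ p).contMDiffOn (fun x hx ↦ ?_) q hq v
    rw [(hUs hx).2]
    exact Submodule.mem_span_singleton_self _
  have hcov : ∀ p, ∀ᶠ q in 𝓝 p, ∀ v w : TangentSpace I q, (inner ℝ (D.cov (ξ p) q v) w : ℝ) =
      inner ℝ v (ξ p q) * W.leeForm q w - W.leeForm q (ξ p q) * inner ℝ v w := by
    intro p
    filter_upwards [(hξT p).eventually_nhds, hmem p] with q hq hqm
    exact W.inner_cov_of_mem_span hD (hξ p) (hq.mono fun y hy ↦ hy.1) hqm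
  let A' : M → Π x : M, TangentSpace I x := fun p q ↦
    D.cov (ξ p) q (ξ p q) + W.leeForm q (ξ p q) • ξ p q
  have hA' : ∀ p, ∀ᶠ q in 𝓝 p, ∀ w, (inner ℝ (A' p q) w : ℝ) = W.leeForm q w := by
    intro p
    filter_upwards [hcov p, hξT p] with q hq hq1 w
    simp only [A', inner_add_left, inner_smul_left, hq, hq1.1, RCLike.conj_to_real]
    ring
  let A : Π x : M, TangentSpace I x := fun q ↦ A' q q
  have hA : ∀ q w, (inner ℝ (A q) w : ℝ) = W.leeForm q w := fun q ↦ (hA' q).self_of_nhds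
  have hAA' : ∀ p, ∀ᶠ q in 𝓝 p, A q = A' p q := by
    intro p
    filter_upwards [hA' p] with q hq
    exact ext_inner_right ℝ fun w ↦ by rw [hA, hq]
  have hlee : ∀ p, CMDiff ∞ (fun q ↦ W.leeForm q (ξ p q)) := by
    intro p
    have := ContMDiff.clm_bundle_apply (E₂ := Bundle.Trivial M ℝ) W.contMDiff_leeForm (hξ p)
    intro q
    have hq := this q
    simp only [contMDiffAt_totalSpace] at hq
    exact hq.2
  have hAs : CMDiff ∞ (T% A) := by
    intro p
    have h1 : CMDiff ∞ (T% (A' p)) :=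
      (contMDiff_cov D (hξ p) (hξ p)).add_section ((hlee p).smul_section (hξ p))
    refine (h1 p).congr_of_eventuallyEq ?_
    filter_upwards [hAA' p] with q hq
    rw [hq]
  refine ⟨A, hAs, fun p ↦ ⟨ξ p, hξ p, ?_⟩⟩
  filter_upwards [hcov p, hξT p] with q hq hq1
  refine ⟨⟨hq1.1, fun v ↦ ext_inner_right ℝ fun w ↦ ?_⟩, hq1.2⟩
  rw [hq, inner_sub_left, inner_smul_left, inner_smul_left, hA, hA]
  simp

end WeylConnection

section IntegralCurves

open Filter Topology

variable {E : Type*} [NormedAddCommGroup E] [NormedSpace ℝ E] [FiniteDimensional ℝ E]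
  {H : Type*} [TopologicalSpace H] {I : ModelWithCorners ℝ E H}
  {M : Type*} [TopologicalSpace M] [ChartedSpace H M] [IsManifold I ∞ M]
  {X : Π x : M, TangentSpace I x} {p : M}

theorem IsMIntegralCurveAt.eventually_hasDerivAt_comp {γ : ℝ → M} {t₀ : ℝ} {φ : M → ℝ}
    (hγ : IsMIntegralCurveAt γ X t₀) (hφ : CMDiff ∞ φ) :
    ∀ᶠ t in 𝓝 t₀, HasDerivAt (φ ∘ γ) (d% φ (γ t) (X (γ t))) t := by
  filter_upwards [hγ] with t ht
  have h1 : HasMFDerivAt I 𝓘(ℝ, ℝ) φ (γ t) (mfderiv I 𝓘(ℝ, ℝ) φ (γ t)) :=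
    (hφ.mdiffAt_fun (p := γ t)).hasMFDerivAt
  let L : ℝ →L[ℝ] ℝ := (mfderiv I 𝓘(ℝ, ℝ) φ (γ t)).comp
    (ContinuousLinearMap.smulRight (1 : ℝ →L[ℝ] ℝ) (X (γ t)))
  have h2 : HasFDerivAt (φ ∘ γ) L t := hasMFDerivAt_iff_hasFDerivAt.1 (h1.comp t ht)
  have h3 := h2.hasDerivAt
  refine h3.congr_deriv ?_
  change mfderiv I 𝓘(ℝ, ℝ) φ (γ t) ((1 : ℝ) • X (γ t)) = _
  rw [one_smul]
  rfl

/-- If `φ` has a local maximum at `p` relative to the level set of `μ` and `X` is tangent to the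
level sets of `μ`, then the derivative of `φ` in the direction `X` vanishes at `p`. -/
theorem lieDerivative_eq_zero_of_isMax_level [BoundarylessManifold I M] {μ φ : M → ℝ}
    (hμ : CMDiff ∞ μ) (hφ : CMDiff ∞ φ) (hX : CMDiff ∞ (T% X))
    (h0 : ∀ᶠ y in 𝓝 p, d% μ y (X y) = 0) (hmax : ∀ᶠ y in 𝓝 p, μ y = μ p → φ y ≤ φ p) :
    d% φ p (X p) = 0 := by
  obtain ⟨γ, hγ0, hγ⟩ := exists_isMIntegralCurveAt_of_contMDiffAt_boundaryless (t₀ := 0)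
    ((hX.of_le (by simp)).contMDiffAt (x := p) : CMDiffAt 1 (T% X) p)
  have hc : Tendsto γ (𝓝 0) (𝓝 p) := by
    have := hγ.self_of_nhds.continuousAt
    rwa [ContinuousAt, hγ0] at this
  obtain ⟨ε, hε, hball⟩ := Metric.eventually_nhds_iff_ball.1
    ((hγ.eventually_hasDerivAt_comp hμ).and (hc.eventually h0))
  have hconst : ∀ t ∈ Metric.ball (0 : ℝ) ε, (μ ∘ γ) t = (μ ∘ γ) 0 := by
    intro t ht
    refine (Metric.isOpen_ball).is_const_of_deriv_eq_zero (Metric.isPreconnected_ball)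
      (fun s hs ↦ (hball s hs).1.differentiableAt.differentiableWithinAt) (fun s hs ↦ ?_) ht
      (Metric.mem_ball_self hε)
    rw [(hball s hs).1.deriv, (hball s hs).2]
    rfl
  have hloc : IsLocalMax (φ ∘ γ) 0 := by
    filter_upwards [hc.eventually hmax, Metric.ball_mem_nhds 0 hε] with t ht htb
    have := hconst t htb
    simp only [Function.comp_apply, hγ0] at this ⊢
    exact ht this
  have := hloc.hasDerivAt_eq_zero (hγ.eventually_hasDerivAt_comp hφ).self_of_nhds
  rwa [hγ0] at this

theorem IsLocalMax.mvfderiv_eq_zero [BoundarylessManifold I M] [T2Space M] {φ : M → ℝ}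
    (hφ : CMDiff ∞ φ) (h : IsLocalMax φ p) (v : TangentSpace I p) : d% φ p v = 0 := by
  obtain ⟨X, hX, rfl⟩ := exists_contMDiff_apply_eq v
  refine lieDerivative_eq_zero_of_isMax_level (μ := fun _ ↦ 0) contMDiff_const hφ hX ?_ ?_
  · exact Eventually.of_forall fun y ↦ by rw [mvfderiv_const]; rfl
  · filter_upwards [h] with y hy _ using hy

end IntegralCurves

section Compact

open Filter Topology

variable {E : Type*} [NormedAddCommGroup E] [NormedSpace ℝ E] [FiniteDimensional ℝ E]
  {H : Type*} [TopologicalSpace H] {I : ModelWithCorners ℝ E H}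
  {M : Type*} [TopologicalSpace M] [ChartedSpace H M] [IsManifold I ∞ M] [T2Space M]
  [RiemannianBundle (fun x : M ↦ TangentSpace I x)]
  [IsContMDiffRiemannianBundle I ∞ E (fun x : M ↦ TangentSpace I x)]
  {A : Π x : M, TangentSpace I x} {κ : ℝ}
  {D : LinearConnection I M}

theorem exists_ne_zero_inner_eq_zero {q : M} (hn : 2 ≤ Module.finrank ℝ E)
    (u : TangentSpace I q) : ∃ v : TangentSpace I q, v ≠ 0 ∧ (inner ℝ v u : ℝ) = 0 := by
  have : FiniteDimensional ℝ (TangentSpace I q) := inferInstanceAs (FiniteDimensional ℝ E)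
  have hfr : Module.finrank ℝ (TangentSpace I q) = Module.finrank ℝ E := rfl
  have hker : LinearMap.ker (innerₛₗ ℝ u) ≠ ⊥ := by
    apply LinearMap.ker_ne_bot_of_finrank_lt
    rw [Module.finrank_self]
    omega
  obtain ⟨v, hv, hv0⟩ := (Submodule.ne_bot_iff _).1 hker
  rw [LinearMap.mem_ker] at hv
  exact ⟨v, hv0, by rw [real_inner_comm]; simpa using hv⟩

/-- A compact manifold of constant positive curvature and dimension at least three has no
umbilical foliation of codimension one. -/
theorem not_umbilicNormal_of_three_le_finrank [BoundarylessManifold I M] [CompactSpace M]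
    [Nonempty M] (hκ0 : 0 < κ) (hD : D.IsLeviCivita)
    (hκ : ∀ X Y : Π x : M, TangentSpace I x, CMDiff ∞ (T% X) → CMDiff ∞ (T% Y) →
      ∀ x : M, LinearIndependent ℝ ![X x, Y x] → D.sectionalCurvature X Y x = κ)
    (hn : 3 ≤ Module.finrank ℝ E) (hA : CMDiff ∞ (T% A)) {L : Π x : M, Submodule ℝ (TangentSpace I x)}
    (h : ∀ p, ∃ ξ : Π x : M, TangentSpace I x, CMDiff ∞ (T% ξ) ∧ ∀ᶠ y in 𝓝 p,
      IsUmbilicNormalAt D A ξ y ∧ L y = Submodule.span ℝ {ξ y}) : False := by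
  choose ξ hξ hξL using h
  let μ : M → M → ℝ := fun p y ↦ inner ℝ (A y) (ξ p y)
  have hμ : ∀ p, CMDiff ∞ (μ p) := fun p ↦ contMDiff_inner hA (hξ p)
  let f : M → ℝ := fun p ↦ μ p p ^ 2
  have hf : ∀ p, ∀ᶠ y in 𝓝 p, f y = μ p y ^ 2 := by
    intro p
    filter_upwards [hξL p] with y hy
    have h1 := (hξL y).self_of_nhds
    have h2 : ξ p y ∈ Submodule.span ℝ {ξ y y} := by
      rw [← h1.2, hy.2]; exact Submodule.mem_span_singleton_self _
    obtain ⟨c, hc⟩ := Submodule.mem_span_singleton.1 h2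
    have h3 := hy.1.inner_self
    rw [← hc, inner_smul_left, inner_smul_right, h1.1.inner_self] at h3
    simp only [RCLike.conj_to_real] at h3
    simp only [f, μ]
    rw [← hc, inner_smul_right]
    linear_combination -(inner ℝ (A y) (ξ y y)) ^ 2 * h3
  have hfc : Continuous f := by
    rw [continuous_iff_continuousAt]
    intro p
    exact ((hμ p).continuous.pow 2).continuousAt.congr (by filter_upwards [hf p] with y hy using hy.symm)
  obtain ⟨p₀, -, hp₀⟩ := isCompact_univ.exists_isMaxOn Set.univ_nonempty hfc.continuousOn
  have hle : ∀ y, f y ≤ f p₀ := fun y ↦ hp₀ (Set.mem_univ y)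
  let g : M → ℝ := fun y ↦ inner ℝ (A y) (A y)
  have hg : CMDiff ∞ g := contMDiff_inner hA hA
  have hKc : IsCompact {y | f y = f p₀} := (isClosed_eq hfc continuous_const).isCompact
  obtain ⟨p, hpK, hpmax⟩ := hKc.exists_isMaxOn ⟨p₀, rfl⟩ hg.continuous.continuousOn
  have hpK : f p = f p₀ := hpK
  have hgmax : ∀ y, f y = f p₀ → g y ≤ g p := fun y hy ↦ hpmax hy
  have hnorm : ∀ᶠ y in 𝓝 p, IsUmbilicNormalAt D A (ξ p) y := (hξL p).mono fun y hy ↦ hy.1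
  have hu := hnorm.self_of_nhds
  have hdμ : ∀ v, d% (μ p) p v = 0 := by
    intro v
    have habs : ∀ᶠ y in 𝓝 p, |μ p y| ≤ |μ p p| := by
      filter_upwards [hf p] with y hy
      rw [← sq_le_sq, ← hy]
      exact (hle y).trans_eq hpK.symm
    rcases le_total 0 (μ p p) with h0 | h0
    · refine IsLocalMax.mvfderiv_eq_zero (hμ p) ?_ v
      filter_upwards [habs] with y hy
      exact (le_abs_self _).trans (hy.trans_eq (abs_of_nonneg h0))
    · have h1 : d% (fun y ↦ - μ p y) p v = 0 := by
        refine IsLocalMax.mvfderiv_eq_zero (hμ p).neg ?_ v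
        filter_upwards [habs] with y hy
        exact (neg_le_abs _).trans (hy.trans_eq (abs_of_nonpos h0))
      rw [mvfderiv_fun_neg, neg_apply] at h1
      exact neg_eq_zero.1 h1
  let P : (Π x : M, TangentSpace I x) → Π x : M, TangentSpace I x :=
    fun Y ↦ Y - (fun y ↦ (inner ℝ (Y y) (ξ p y) : ℝ)) • ξ p
  have hPs : ∀ {Y : Π x : M, TangentSpace I x}, CMDiff ∞ (T% Y) → CMDiff ∞ (T% (P Y)) := fun hY ↦
    hY.sub_section ((contMDiff_inner hY (hξ p)).smul_section (hξ p))
  have hPo : ∀ Y, ∀ᶠ y in 𝓝 p, (inner ℝ (P Y y) (ξ p y) : ℝ) = 0 := by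
    intro Y
    filter_upwards [hnorm] with y hy
    simp only [P, Pi.sub_apply, Pi.smul_apply', inner_sub_left, inner_smul_left,
      RCLike.conj_to_real, hy.inner_self]
    ring
  have hlevel : ∀ {Y : Π x : M, TangentSpace I x} {φ : M → ℝ}, CMDiff ∞ (T% Y) → CMDiff ∞ φ →
      (∀ᶠ y in 𝓝 p, f y = f p₀ → φ y ≤ φ p) → d% φ p (P Y p) = 0 := by
    intro Y φ hY hφ hm
    refine lieDerivative_eq_zero_of_isMax_level (hμ p) hφ (hPs hY) ?_ ?_
    · filter_upwards [hnorm.eventually_nhds, hPo Y] with y hy hy2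
      exact lieDerivative_umbilicNormal_eq_zero hD hκ hn hA (hξ p) hy hy2
    · filter_upwards [hm, hf p] with y hy hy2 hy3
      apply hy
      rw [hy2, hy3, ← hpK]
  have hric : ∀ {v : TangentSpace I p}, (inner ℝ v (ξ p p) : ℝ) = 0 →
      (inner ℝ (D.cov A p v) v : ℝ) = κ * inner ℝ v v + inner ℝ (A p) v ^ 2 := by
    intro v hv
    have := inner_cov_umbilicNormal hD hκ hA (hξ p) hnorm hv
    rwa [hdμ, sub_zero] at this
  have hAp : P A p = 0 := by
    have h1 := hlevel hA hg (Eventually.of_forall hgmax)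
    have ho := (hPo A).self_of_nhds
    have hsplit : A p = P A p + μ p p • ξ p p := by
      simp [P, μ]
    have h2 := hu.lieDerivative_inner hD hA (hξ p) (P A p)
    rw [hdμ, ho] at h2
    have h3 := hric ho
    have h4 : (inner ℝ (A p) (P A p) : ℝ) = inner ℝ (P A p) (P A p) := by
      conv_lhs => rw [hsplit]
      rw [inner_add_left, inner_smul_left, real_inner_comm (P A p) (ξ p p), ho]
      simp
    have h5 : (inner ℝ (D.cov A p (P A p)) (A p) : ℝ) =
        inner ℝ (D.cov A p (P A p)) (P A p) + μ p p * inner ℝ (D.cov A p (P A p)) (ξ p p) := by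
      conv_lhs => rw [hsplit]
      rw [inner_add_right, inner_smul_right]
    rw [hD.lieDerivative_inner hA hA, real_inner_comm (D.cov A p (P A p)) (A p)] at h1
    rw [h4] at h2 h3
    set t : ℝ := inner ℝ (P A p) (P A p) with ht
    have ht0 : 0 ≤ t := real_inner_self_nonneg
    have h6 : (inner ℝ (D.cov A p (P A p)) (ξ p p) : ℝ) = μ p p * t := by
      simp only [μ]; linarith
    rw [h5, h3, h6] at h1
    have h7 : t * (κ + t + μ p p ^ 2) = 0 := by linarith
    have h8 : 0 < κ + t + μ p p ^ 2 := by positivity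
    exact inner_self_eq_zero.1 ((mul_eq_zero.1 h7).resolve_right h8.ne')
  have hPnorm : ∀ y, IsUmbilicNormalAt D A (ξ p) y →
      (inner ℝ (P A y) (P A y) : ℝ) = g y - μ p y ^ 2 := by
    intro y hy
    simp only [P, Pi.sub_apply, Pi.smul_apply', inner_sub_left, inner_smul_left, inner_sub_right,
      inner_smul_right, RCLike.conj_to_real, hy.inner_self, real_inner_comm (A y) (ξ p y), g, μ]
    ring
  have hgp : g p = f p₀ := by
    have := hPnorm p hu
    rw [hAp, inner_zero_left] at this
    rw [← hpK]
    simp only [f]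
    linarith
  have hAK : ∀ᶠ y in 𝓝 p, f y = f p₀ → A y = μ p y • ξ p y := by
    filter_upwards [hnorm, hf p] with y hy hfy hyK
    have h1 := hPnorm y hy
    have h2 := hgmax y hyK
    have h3 : (inner ℝ (P A y) (P A y) : ℝ) = 0 :=
      le_antisymm (by rw [h1, ← hfy, hyK, ← hgp]; linarith) real_inner_self_nonneg
    have h4 : P A y = 0 := inner_self_eq_zero.1 h3
    simpa [P, sub_eq_zero] using h4
  obtain ⟨v, hv0, hv⟩ := exists_ne_zero_inner_eq_zero (by omega) (ξ p p)
  obtain ⟨Y, hY, rfl⟩ := exists_contMDiff_apply_eq v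
  have hPY : P Y p = Y p := by simp [P, hv]
  have hzero : ∀ᶠ y in 𝓝 p, f y = f p₀ → (inner ℝ (A y) (P Y y) : ℝ) = 0 := by
    filter_upwards [hAK, hPo Y] with y hy hyo hyK
    rw [hy hyK, inner_smul_left, real_inner_comm, hyo, mul_zero]
  have hzp := hzero.self_of_nhds hpK
  have h1 := hlevel (φ := fun y ↦ inner ℝ (A y) (P Y y)) hY (contMDiff_inner hA (hPs hY)) (by
    filter_upwards [hzero] with y hy hyK
    rw [hy hyK, hzp])
  have h2 : d% (fun y ↦ (inner ℝ (P Y y) (ξ p y) : ℝ)) p (P Y p) = 0 := by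
    refine IsLocalMax.mvfderiv_eq_zero (contMDiff_inner (hPs hY) (hξ p)) ?_ _
    filter_upwards [hPo Y] with y hy
    rw [hy, (hPo Y).self_of_nhds]
  rw [hD.lieDerivative_inner hA (hPs hY)] at h1
  rw [hD.lieDerivative_inner (hPs hY) (hξ p), hu.cov_eq, (hPo Y).self_of_nhds] at h2
  rw [hric (hPo Y).self_of_nhds, hAK.self_of_nhds hpK, inner_smul_left, inner_smul_left,
    real_inner_comm (P Y p) (ξ p p), (hPo Y).self_of_nhds,
    real_inner_comm (D.cov (P Y) p (P Y p)) (ξ p p)] at h1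
  rw [inner_sub_right, inner_smul_right, inner_smul_right] at h2
  simp only [RCLike.conj_to_real] at h1 h2
  have h3 : (0 : ℝ) < inner ℝ (P Y p) (P Y p) := by rw [hPY]; exact real_inner_self_pos.2 hv0
  have h4 : (inner ℝ (D.cov (P Y) p (P Y p)) (ξ p p) : ℝ) = μ p p * inner ℝ (P Y p) (P Y p) := by
    simp only [μ]; linarith
  rw [h4] at h1
  have h5 : (κ + μ p p ^ 2) * inner ℝ (P Y p) (P Y p) = 0 := by linarith
  have h6 : 0 < κ + μ p p ^ 2 := by positivity
  exact (mul_pos h6 h3).ne' h5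

end Compact

section ChartFields

open Filter Topology

variable {E : Type*} [NormedAddCommGroup E] [NormedSpace ℝ E] [FiniteDimensional ℝ E]
  {H : Type*} [TopologicalSpace H] {I : ModelWithCorners ℝ E H}
  {M : Type*} [TopologicalSpace M] [ChartedSpace H M] [IsManifold I ∞ M]
  {A X Y : Π x : M, TangentSpace I x} {c y : M} {v w : E}

variable (I) in
/-- The coordinate vector field in the direction `v`, in the preferred chart at `c`. -/
noncomputable def chartField (c : M) (v : E) (x : M) : TangentSpace I x :=
  (trivializationAt E (TangentSpace I : M → Type _) c).symmL ℝ x v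

/-- The coordinates of a vector field in the preferred chart at `c`. -/
noncomputable def chartCoord (c : M) (A : Π x : M, TangentSpace I x) (x : M) : E :=
  (trivializationAt E (TangentSpace I : M → Type _) c).continuousLinearMapAt ℝ x (A x)

theorem mem_baseSet_of_mem_extChartAt_source (hy : y ∈ (extChartAt I c).source) :
    y ∈ (trivializationAt E (TangentSpace I : M → Type _) c).baseSet := by
  rwa [TangentBundle.trivializationAt_baseSet, ← extChartAt_source I]

theorem chartField_chartCoord (hy : y ∈ (extChartAt I c).source) :
    chartField I c (chartCoord c A y) y = A y :=
  Trivialization.symmL_continuousLinearMapAt _ (mem_baseSet_of_mem_extChartAt_source hy) _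

theorem chartCoord_chartField (hy : y ∈ (extChartAt I c).source) :
    chartCoord c (chartField I c v) y = v :=
  Trivialization.continuousLinearMapAt_symmL _ (mem_baseSet_of_mem_extChartAt_source hy) _

theorem contMDiffOn_chartField (c : M) (v : E) :
    CMDiff[(extChartAt I c).source] ∞ (T% (chartField I c v)) := by
  have : IsManifold I (∞ + 1) M := by simpa
  have : ContMDiffVectorBundle ∞ E (TangentSpace I : M → Type _) I :=
    TangentBundle.contMDiffVectorBundle
  rw [extChartAt_source, ← TangentBundle.trivializationAt_baseSet (I := I),
    Trivialization.contMDiffOn_section_baseSet_iff]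
  apply (contMDiffOn_const (c := v)).congr
  intro y hy
  rw [chartField, Trivialization.symmL_apply _ hy, Trivialization.apply_mk_symm _ hy]

theorem contMDiffOn_chartCoord (hA : CMDiff ∞ (T% A)) (c : M) :
    CMDiff[(extChartAt I c).source] ∞ (chartCoord c A) := by
  have : IsManifold I (∞ + 1) M := by simpa
  have : ContMDiffVectorBundle ∞ E (TangentSpace I : M → Type _) I :=
    TangentBundle.contMDiffVectorBundle
  rw [extChartAt_source, ← TangentBundle.trivializationAt_baseSet (I := I)]
  have h := hA.contMDiffOn (s := (trivializationAt E (TangentSpace I : M → Type _) c).baseSet)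
  rw [Trivialization.contMDiffOn_section_baseSet_iff] at h
  apply h.congr
  intro y hy
  rw [TangentBundle.trivializationAt_baseSet] at hy
  simp [chartCoord, Trivialization.continuousLinearMapAt_apply, Trivialization.linearMapAt_apply, hy]

theorem fderiv_comp_extChartAt_symm [I.Boundaryless] {f : M → ℝ}
    (hy : y ∈ (extChartAt I c).source) (hf : MDiffAt f y) (v : E) :
    fderiv ℝ (f ∘ (extChartAt I c).symm) (extChartAt I c y) v = d% f y (chartField I c v y) := by
  have hyc : y ∈ (chartAt H c).source := by rwa [← extChartAt_source I]
  have ht : extChartAt I c y ∈ (extChartAt I c).target := (extChartAt I c).map_source hy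
  have h1 := mdifferentiableWithinAt_extChartAt_symm ht
  rw [I.range_eq_univ, mdifferentiableWithinAt_univ] at h1
  have h3 := mvfderiv_comp_apply_of_eq _ hf h1 ((extChartAt I c).left_inv hy) v
  rw [mvfderiv, mfderiv_eq_fderiv] at h3
  refine Eq.trans ?_ (h3.trans ?_)
  · rfl
  unfold chartField
  rw [TangentBundle.symmL_trivializationAt hyc, I.range_eq_univ, mfderivWithin_univ]
  rfl

variable [T2Space M]

theorem exists_contMDiff_fun_eventuallyEq {U : Set M} (hU : IsOpen U) (hy : y ∈ U)
    {f : M → ℝ} (hf : CMDiff[U] ∞ f) :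
    ∃ g : M → ℝ, CMDiff ∞ g ∧ ∀ᶠ z in 𝓝 y, g z = f z := by
  obtain ⟨φ, -, hφ⟩ := ((SmoothBumpFunction.nhds_basis_tsupport (I := I) y).mem_iff).1
    (hU.mem_nhds hy)
  refine ⟨fun z ↦ φ z • f z, contMDiff_of_tsupport fun x hx ↦ ?_, ?_⟩
  · have hxU : x ∈ U := hφ (tsupport_smul_subset_left _ _ hx)
    exact φ.contMDiff.contMDiffAt.smul (hf.contMDiffAt (hU.mem_nhds hxU))
  · filter_upwards [φ.eventuallyEq_one] with z hz
    simp [hz]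

theorem mlieBracket_eq_zero_of_eventuallyEq_chartField [I.Boundaryless]
    (hy : y ∈ (extChartAt I c).source) (hX : CMDiff ∞ (T% X)) (hY : CMDiff ∞ (T% Y))
    (hXv : ∀ᶠ z in 𝓝 y, X z = chartField I c v z) (hYw : ∀ᶠ z in 𝓝 y, Y z = chartField I c w z) :
    mlieBracket I X Y y = 0 := by
  have hs : IsOpen (extChartAt I c).source := isOpen_extChartAt_source c
  suffices h : chartCoord c (mlieBracket I X Y) y = 0 by
    rw [← chartField_chartCoord (A := mlieBracket I X Y) hy, h]
    simp [chartField]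
  refine (Module.forall_dual_apply_eq_zero_iff ℝ _).1 fun ℓ ↦ ?_
  let ℓ' : E →L[ℝ] ℝ := LinearMap.toContinuousLinearMap ℓ
  have hsm : CMDiff[(extChartAt I c).source] ∞ (fun z ↦ ℓ' (extChartAt I c z)) := by
    rw [extChartAt_source]
    exact ℓ'.contMDiff.comp_contMDiffOn contMDiffOn_extChartAt
  obtain ⟨h, hh, hhe⟩ := exists_contMDiff_fun_eventuallyEq hs hy hsm
  have key : ∀ᶠ z in 𝓝 y, ∀ u, d% h z (chartField I c u z) = ℓ' u := by
    filter_upwards [hs.mem_nhds hy, hhe.eventually_nhds] with z hz hhz u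
    rw [← fderiv_comp_extChartAt_symm hz hh.mdiffAt_fun]
    have h1 : h ∘ (extChartAt I c).symm =ᶠ[𝓝 (extChartAt I c z)] ℓ' := by
      have ht : (extChartAt I c).target ∈ 𝓝 (extChartAt I c z) :=
        (isOpen_extChartAt_target c).mem_nhds ((extChartAt I c).map_source hz)
      have hc := continuousAt_extChartAt_symm' (I := I) hz
      rw [ContinuousAt, (extChartAt I c).left_inv hz] at hc
      filter_upwards [hc.eventually hhz, ht] with x hx hxt
      rw [Function.comp_apply, hx, (extChartAt I c).right_inv hxt]
    rw [h1.fderiv_eq, ContinuousLinearMap.fderiv]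
  have hconst : ∀ {Z : Π x : M, TangentSpace I x} {u : E},
      (∀ᶠ z in 𝓝 y, Z z = chartField I c u z) → ∀ v : TangentSpace I y,
        d% (fun z ↦ d% h z (Z z)) y v = 0 := by
    intro Z u hZ v
    have h1 : (fun z ↦ d% h z (Z z)) =ᶠ[𝓝 y] fun _ ↦ ℓ' u := by
      filter_upwards [hZ, key] with z hz hk
      rw [hz, hk]
    rw [h1.mvfderiv_eq, mvfderiv_const]
    rfl
  have hb := lieDerivative_mlieBracket (p := y) hh hX hY
  rw [hconst hXv, hconst hYw, sub_zero] at hb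
  have h3 := key.self_of_nhds (chartCoord c (mlieBracket I X Y) y)
  rw [chartField_chartCoord hy, hb] at h3
  exact h3.symm

theorem chartField_eq_chartField [I.Boundaryless] {c' : M} (hy : y ∈ (extChartAt I c).source)
    (hy' : y ∈ (extChartAt I c').source) (v : E) :
    chartField I c v y = chartField I c'
      (fderiv ℝ (extChartAt I c' ∘ (extChartAt I c).symm) (extChartAt I c y) v) y := by
  have hyc : y ∈ (chartAt H c).source := by rwa [← extChartAt_source I]
  have hyc' : y ∈ (chartAt H c').source := by rwa [← extChartAt_source I]
  have e := tangentCoordChange_def (I := I) (x := c) (y := c') (z := y)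
  rw [I.range_eq_univ, fderivWithin_univ] at e
  rw [← e]
  unfold chartField
  rw [TangentBundle.symmL_trivializationAt_eq_core hyc,
    TangentBundle.symmL_trivializationAt_eq_core hyc']
  exact (tangentCoordChange_comp (I := I) (w := c) (x := c') (y := y) (z := y)
    ⟨⟨hy, hy'⟩, mem_extChartAt_source y⟩).symm

end ChartFields

section Surface

open Filter Topology

theorem EuclideanSpace.eq_smul_single_add (v : EuclideanSpace ℝ (Fin 2)) :
    v = v 0 • EuclideanSpace.single 0 1 + v 1 • EuclideanSpace.single 1 1 := by
  ext i
  fin_cases i <;> simp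

/-- The derivative of a `2 × 2` Gram determinant whose vectors have derivatives `u₀`, `u₁`. -/
theorem gram_derivative {T : Type*} [NormedAddCommGroup T] [InnerProductSpace ℝ T]
    {x₀ x₁ u₀ u₁ : T} {a b c d : ℝ} (h₀ : u₀ = a • x₀ + b • x₁) (h₁ : u₁ = c • x₀ + d • x₁) :
    (inner ℝ u₀ x₀ + inner ℝ x₀ u₀) * inner ℝ x₁ x₁ + inner ℝ x₀ x₀ * (inner ℝ u₁ x₁ + inner ℝ x₁ u₁)
      - 2 * inner ℝ x₀ x₁ * (inner ℝ u₀ x₁ + inner ℝ x₀ u₁) =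
    (2 * (a + d) * (inner ℝ x₀ x₀ * inner ℝ x₁ x₁ - inner ℝ x₀ x₁ ^ 2) : ℝ) := by
  subst h₀ h₁
  simp only [inner_add_left, inner_add_right, inner_smul_left, inner_smul_right,
    RCLike.conj_to_real, real_inner_comm x₀ x₁]
  ring

theorem gram_change {T : Type*} [NormedAddCommGroup T] [InnerProductSpace ℝ T]
    {x₀ x₁ u₀ u₁ : T} {a b c d : ℝ} (h₀ : u₀ = a • x₀ + b • x₁) (h₁ : u₁ = c • x₀ + d • x₁) :
    inner ℝ u₀ u₀ * inner ℝ u₁ u₁ - inner ℝ u₀ u₁ ^ 2 =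
    ((a * d - c * b) ^ 2 * (inner ℝ x₀ x₀ * inner ℝ x₁ x₁ - inner ℝ x₀ x₁ ^ 2) : ℝ) := by
  subst h₀ h₁
  simp only [inner_add_left, inner_add_right, inner_smul_left, inner_smul_right,
    RCLike.conj_to_real, real_inner_comm x₀ x₁]
  ring

variable {H : Type*} [TopologicalSpace H] {I : ModelWithCorners ℝ (EuclideanSpace ℝ (Fin 2)) H}
  {M : Type*} [TopologicalSpace M] [ChartedSpace H M] [IsManifold I ∞ M]
  {A : Π x : M, TangentSpace I x} {c c' q : M}

variable (I) in
/-- The coordinate vector fields of the preferred chart at `c`. -/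
noncomputable def chartFrame (c : M) (i : Fin 2) : Π x : M, TangentSpace I x :=
  chartField I c (EuclideanSpace.single i 1)

variable (I) in
/-- The coordinates of a tangent vector in the preferred chart at `c`. -/
noncomputable def chartCoeff (c q : M) (i : Fin 2) : TangentSpace I q →ₗ[ℝ] ℝ :=
  (EuclideanSpace.proj (𝕜 := ℝ) i : EuclideanSpace ℝ (Fin 2) →L[ℝ] ℝ).toLinearMap ∘ₗ
    ((trivializationAt (EuclideanSpace ℝ (Fin 2)) (TangentSpace I : M → Type _) c).continuousLinearMapAt
      ℝ q).toLinearMap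

theorem chartField_eq_frame (v : EuclideanSpace ℝ (Fin 2)) :
    chartField I c v q = v 0 • chartFrame I c 0 q + v 1 • chartFrame I c 1 q := by
  conv_lhs => rw [EuclideanSpace.eq_smul_single_add v]
  simp only [chartFrame, chartField, map_add, map_smul]

theorem eq_chartCoeff_smul (hq : q ∈ (extChartAt I c).source) (v : TangentSpace I q) :
    v = chartCoeff I c q 0 v • chartFrame I c 0 q + chartCoeff I c q 1 v • chartFrame I c 1 q := by
  have h := chartField_eq_frame (I := I) (c := c) (q := q)
    ((trivializationAt (EuclideanSpace ℝ (Fin 2)) (TangentSpace I : M → Type _) c).continuousLinearMapAt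
      ℝ q v)
  rw [chartField, Trivialization.symmL_continuousLinearMapAt _
    (mem_baseSet_of_mem_extChartAt_source hq)] at h
  exact h

theorem chartCoeff_chartFrame (hq : q ∈ (extChartAt I c).source) (i j : Fin 2) :
    chartCoeff I c q i (chartFrame I c j q) = if i = j then 1 else 0 := by
  have := chartCoord_chartField (I := I) (v := EuclideanSpace.single j (1 : ℝ)) hq
  have h2 := congrArg (fun w : EuclideanSpace ℝ (Fin 2) ↦ w i) this
  simpa [chartCoord, chartFrame, chartCoeff, eq_comm] using h2

theorem trace_eq_chartCoeff (hq : q ∈ (extChartAt I c).source)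
    (L : TangentSpace I q →ₗ[ℝ] TangentSpace I q) :
    LinearMap.trace ℝ _ L = chartCoeff I c q 0 (L (chartFrame I c 0 q))
      + chartCoeff I c q 1 (L (chartFrame I c 1 q)) := by
  have hb := mem_baseSet_of_mem_extChartAt_source hq
  let e := (trivializationAt (EuclideanSpace ℝ (Fin 2)) (TangentSpace I : M → Type _)
    c).continuousLinearEquivAt ℝ q hb
  let B := (EuclideanSpace.basisFun (Fin 2) ℝ).toBasis.map e.symm.toLinearEquiv
  rw [LinearMap.trace_eq_matrix_trace ℝ B, Matrix.trace, Fin.sum_univ_two]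
  simp only [Matrix.diag_apply, LinearMap.toMatrix_apply]
  have h1 : ∀ i, B i = chartFrame I c i q := by
    intro i
    simp only [B, Module.Basis.map_apply, OrthonormalBasis.coe_toBasis,
      EuclideanSpace.basisFun_apply, chartFrame, chartField]
    exact congrFun (Trivialization.symm_continuousLinearEquivAt_eq _ hb) _
  have h2 : ∀ i v, B.repr v i = chartCoeff I c q i v := by
    intro i v
    have h3 : e v = (trivializationAt (EuclideanSpace ℝ (Fin 2)) (TangentSpace I : M → Type _)
        c).continuousLinearMapAt ℝ q v :=
      congrFun (Trivialization.coe_continuousLinearEquivAt_eq _ hb) v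
    rw [chartCoeff, LinearMap.comp_apply, ContinuousLinearMap.coe_coe, ContinuousLinearMap.coe_coe,
      ← h3]
    rfl
  simp only [h1, h2]

variable [RiemannianBundle (fun x : M ↦ TangentSpace I x)]
  [IsContMDiffRiemannianBundle I ∞ (EuclideanSpace ℝ (Fin 2)) (fun x : M ↦ TangentSpace I x)]

variable (I) in
noncomputable def chartGram (c y : M) : ℝ :=
  inner ℝ (chartFrame I c 0 y) (chartFrame I c 0 y) * inner ℝ (chartFrame I c 1 y) (chartFrame I c 1 y)
    - inner ℝ (chartFrame I c 0 y) (chartFrame I c 1 y) ^ 2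

variable (I) in
/-- The density of the Riemannian measure in the preferred chart at `c`. -/
noncomputable def chartDensity (c y : M) : ℝ := √(chartGram I c y)

theorem chartGram_pos (hq : q ∈ (extChartAt I c).source) : 0 < chartGram I c q := by
  have h0 : chartFrame I c 0 q ≠ 0 := by
    intro h
    have := chartCoeff_chartFrame (I := I) hq 0 0
    rw [h, map_zero] at this
    simp at this
  have h0' : (0 : ℝ) < inner ℝ (chartFrame I c 0 q) (chartFrame I c 0 q) :=
    real_inner_self_pos.2 h0
  let u := (inner ℝ (chartFrame I c 0 q) (chartFrame I c 0 q) : ℝ) • chartFrame I c 1 q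
    - (inner ℝ (chartFrame I c 0 q) (chartFrame I c 1 q) : ℝ) • chartFrame I c 0 q
  have hu : u ≠ 0 := by
    intro h
    have := congrArg (chartCoeff I c q 1) h
    simp only [u, map_sub, map_smul, chartCoeff_chartFrame hq, map_zero] at this
    simp at this
    exact h0 this
  have huu : (inner ℝ u u : ℝ) = inner ℝ (chartFrame I c 0 q) (chartFrame I c 0 q)
      * chartGram I c q := by
    simp only [u, chartGram, inner_sub_left, inner_sub_right, inner_smul_left, inner_smul_right,
      RCLike.conj_to_real, real_inner_comm (chartFrame I c 0 q) (chartFrame I c 1 q)]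
    ring
  have hpos : (0 : ℝ) < inner ℝ u u := real_inner_self_pos.2 hu
  rw [huu] at hpos
  exact (mul_pos_iff_of_pos_left h0').1 hpos

theorem contMDiffOn_chartGram (c : M) : CMDiff[(extChartAt I c).source] ∞ (chartGram I c) := by
  have h : ∀ i j, CMDiff[(extChartAt I c).source] ∞
      (fun y ↦ (inner ℝ (chartFrame I c i y) (chartFrame I c j y) : ℝ)) := fun i j ↦
    ContMDiffOn.inner_bundle (contMDiffOn_chartField c _) (contMDiffOn_chartField c _)
  exact ((h 0 0).mul (h 1 1)).sub ((h 0 1).pow 2)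

theorem contMDiffOn_chartDensity (c : M) :
    CMDiff[(extChartAt I c).source] ∞ (chartDensity I c) := by
  intro y hy
  exact ContMDiffAt.comp_contMDiffWithinAt (g := Real.sqrt) y
    (Real.contDiffAt_sqrt (chartGram_pos hy).ne').contMDiffAt (contMDiffOn_chartGram c y hy)

theorem chartDensity_eq_abs_det_mul [T2Space M] [I.Boundaryless] (hq : q ∈ (extChartAt I c).source)
    (hq' : q ∈ (extChartAt I c').source) :
    chartDensity I c q =
      |(fderiv ℝ (extChartAt I c' ∘ (extChartAt I c).symm) (extChartAt I c q)).det|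
        * chartDensity I c' q := by
  set B := fderiv ℝ (extChartAt I c' ∘ (extChartAt I c).symm) (extChartAt I c q) with hB
  have h : ∀ i, chartFrame I c i q = (B (EuclideanSpace.single i 1)) 0 • chartFrame I c' 0 q
      + (B (EuclideanSpace.single i 1)) 1 • chartFrame I c' 1 q := by
    intro i
    rw [← chartField_eq_frame, hB, ← chartField_eq_chartField hq hq']
    rfl
  have hdet : B.det = (B (EuclideanSpace.single 0 1)) 0 * (B (EuclideanSpace.single 1 1)) 1
      - (B (EuclideanSpace.single 1 1)) 0 * (B (EuclideanSpace.single 0 1)) 1 := by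
    rw [ContinuousLinearMap.det, ← LinearMap.det_toMatrix (EuclideanSpace.basisFun (Fin 2) ℝ).toBasis,
      Matrix.det_fin_two]
    simp [LinearMap.toMatrix_apply]
  have hg := gram_change (h 0) (h 1)
  rw [chartDensity, chartDensity, chartGram, hg, hdet, Real.sqrt_mul (sq_nonneg _), Real.sqrt_sq_eq_abs]
  rfl

end Surface

section LocalDivergence

open Filter Topology

variable {H : Type*} [TopologicalSpace H] {I : ModelWithCorners ℝ (EuclideanSpace ℝ (Fin 2)) H}
  {M : Type*} [TopologicalSpace M] [ChartedSpace H M] [IsManifold I ∞ M] [T2Space M]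
  [RiemannianBundle (fun x : M ↦ TangentSpace I x)]
  [IsContMDiffRiemannianBundle I ∞ (EuclideanSpace ℝ (Fin 2)) (fun x : M ↦ TangentSpace I x)]
  {A X₀ X₁ : Π x : M, TangentSpace I x} {c q : M} {D : LinearConnection I M}

/-- Logarithmic derivative of the Riemannian density. -/
theorem mvfderiv_chartDensity (hD : D.IsLeviCivita) (hq : q ∈ (extChartAt I c).source)
    (hX₀ : CMDiff ∞ (T% X₀)) (hX₁ : CMDiff ∞ (T% X₁))
    (h₀ : ∀ᶠ z in 𝓝 q, X₀ z = chartFrame I c 0 z) (h₁ : ∀ᶠ z in 𝓝 q, X₁ z = chartFrame I c 1 z)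
    (v : TangentSpace I q) :
    d% (chartDensity I c) q v =
      chartDensity I c q * (chartCoeff I c q 0 (D.cov X₀ q v) + chartCoeff I c q 1 (D.cov X₁ q v)) := by
  have hs : (extChartAt I c).source ∈ 𝓝 q := (isOpen_extChartAt_source c).mem_nhds hq
  have hw : MDiffAt (chartDensity I c) q :=
    ((contMDiffOn_chartDensity c).contMDiffAt hs).mdifferentiableAt (by simp)
  have hin : ∀ {Y Z : Π x : M, TangentSpace I x}, CMDiff ∞ (T% Y) → CMDiff ∞ (T% Z) →
      MDiffAt (fun y ↦ (inner ℝ (Y y) (Z y) : ℝ)) q := fun hY hZ ↦ (contMDiff_inner hY hZ).mdiffAt_fun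
  have hgram : (fun y ↦ chartDensity I c y * chartDensity I c y) =ᶠ[𝓝 q] fun y ↦
      inner ℝ (X₀ y) (X₀ y) * inner ℝ (X₁ y) (X₁ y) - inner ℝ (X₀ y) (X₁ y) * inner ℝ (X₀ y) (X₁ y) := by
    filter_upwards [hs, h₀, h₁] with y hy h0 h1
    rw [chartDensity, Real.mul_self_sqrt (chartGram_pos hy).le, chartGram, h0, h1]
    ring
  have hd := congrArg (fun ℓ ↦ ℓ v) hgram.mvfderiv_eq
  have hm : MDiffAt (fun y ↦ inner ℝ (X₀ y) (X₀ y) * inner ℝ (X₁ y) (X₁ y)) q :=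
    (hin hX₀ hX₀).mul (hin hX₁ hX₁)
  have hm' : MDiffAt (fun y ↦ inner ℝ (X₀ y) (X₁ y) * inner ℝ (X₀ y) (X₁ y)) q :=
    (hin hX₀ hX₁).mul (hin hX₀ hX₁)
  rw [mvfderiv_fun_mul hw hw, mvfderiv_fun_sub hm hm', mvfderiv_fun_mul (hin hX₀ hX₀) (hin hX₁ hX₁),
    mvfderiv_fun_mul (hin hX₀ hX₁) (hin hX₀ hX₁)] at hd
  simp only [add_apply, sub_apply, smul_apply, smul_eq_mul,
    hD.lieDerivative_inner hX₀ hX₀, hD.lieDerivative_inner hX₀ hX₁,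
    hD.lieDerivative_inner hX₁ hX₁] at hd
  have e0 := eq_chartCoeff_smul hq (D.cov X₀ q v)
  have e1 := eq_chartCoeff_smul hq (D.cov X₁ q v)
  have key := gram_derivative e0 e1
  rw [h₀.self_of_nhds, h₁.self_of_nhds] at hd
  have hg := hgram.self_of_nhds
  simp only [h₀.self_of_nhds, h₁.self_of_nhds] at hg
  have hpos : 0 < chartDensity I c q := Real.sqrt_pos.2 (chartGram_pos hq)
  apply mul_left_cancel₀ (mul_pos two_pos hpos).ne'
  linear_combination hd + key + 2 * (chartCoeff I c q 0 (D.cov X₀ q v)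
    + chartCoeff I c q 1 (D.cov X₁ q v)) * (-hg)

theorem chart_divergence [I.Boundaryless] (hD : D.IsLeviCivita) (hA : CMDiff ∞ (T% A))
    (hq : q ∈ (extChartAt I c).source) {ρ : M → ℝ} (hρ : CMDiff ∞ ρ) :
    ∑ i, fderiv ℝ ((fun y ↦ chartDensity I c y * ρ y * chartCoord c A y i) ∘ (extChartAt I c).symm)
        (extChartAt I c q) (EuclideanSpace.single i 1) =
      chartDensity I c q * (d% ρ q (A q) + ρ q * LinearMap.trace ℝ _ (D.cov A q).toLinearMap) := by
  have hso := isOpen_extChartAt_source (I := I) c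
  have hs : (extChartAt I c).source ∈ 𝓝 q := hso.mem_nhds hq
  obtain ⟨X₀, hX₀, h₀⟩ := exists_contMDiff_eventuallyEq hso hq
    (contMDiffOn_chartField (I := I) c (EuclideanSpace.single 0 1))
  obtain ⟨X₁, hX₁, h₁⟩ := exists_contMDiff_eventuallyEq hso hq
    (contMDiffOn_chartField (I := I) c (EuclideanSpace.single 1 1))
  have hcoord : ∀ i, CMDiff[(extChartAt I c).source] ∞ (fun y ↦ chartCoord c A y i) := fun i ↦
    (EuclideanSpace.proj (𝕜 := ℝ) i : EuclideanSpace ℝ (Fin 2) →L[ℝ] ℝ).contMDiff.comp_contMDiffOn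
      (contMDiffOn_chartCoord hA c)
  obtain ⟨a, ha, hae⟩ := exists_contMDiff_fun_eventuallyEq hso hq (hcoord 0)
  obtain ⟨b, hb, hbe⟩ := exists_contMDiff_fun_eventuallyEq hso hq (hcoord 1)
  have hw : MDiffAt (chartDensity I c) q :=
    ((contMDiffOn_chartDensity c).contMDiffAt hs).mdifferentiableAt (by simp)
  have hρd : MDiffAt ρ q := hρ.mdiffAt_fun
  have hAe : ∀ᶠ y in 𝓝 q, A y = (a • X₀ + b • X₁) y := by
    filter_upwards [hs, h₀, h₁, hae, hbe] with y hy h0 h1 h2 h3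
    rw [Pi.add_apply, Pi.smul_apply', Pi.smul_apply', h2, h3, h0, h1]
    have h4 := chartField_chartCoord (A := A) hy
    rw [chartField_eq_frame] at h4
    exact h4.symm
  have haX := ha.smul_section hX₀
  have hbX := hb.smul_section hX₁
  have hcov : ∀ v, D.cov A q v = a q • D.cov X₀ q v + d% a q v • X₀ q
      + (b q • D.cov X₁ q v + d% b q v • X₁ q) := by
    intro v
    rw [D.cov_congr hA (haX.add_section hbX) hAe, D.cov_add haX hbX, add_apply,
      D.cov_smul ha hX₀, D.cov_smul hb hX₁]
  have hsymm : D.cov X₁ q (X₀ q) = D.cov X₀ q (X₁ q) := by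
    rw [← sub_eq_zero, LinearConnection.torsionFree_apply hD.1 hX₀ hX₁,
      mlieBracket_eq_zero_of_eventuallyEq_chartField hq hX₀ hX₁ h₀ h₁]
  have e0 : X₀ q = chartFrame I c 0 q := h₀.self_of_nhds
  have e1 : X₁ q = chartFrame I c 1 q := h₁.self_of_nhds
  have hw0 := mvfderiv_chartDensity hD hq hX₀ hX₁ h₀ h₁ (chartFrame I c 0 q)
  have hw1 := mvfderiv_chartDensity hD hq hX₀ hX₁ h₀ h₁ (chartFrame I c 1 q)
  rw [e0, e1] at hsymm
  have hF : ∀ i (f : M → ℝ), CMDiff ∞ f → (∀ᶠ z in 𝓝 q, f z = chartCoord c A z i) → 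
      fderiv ℝ ((fun y ↦ chartDensity I c y * ρ y * chartCoord c A y i) ∘ (extChartAt I c).symm)
        (extChartAt I c q) (EuclideanSpace.single i 1) =
      chartDensity I c q * ρ q * d% f q (chartFrame I c i q) + f q *
        (chartDensity I c q * d% ρ q (chartFrame I c i q)
          + ρ q * d% (chartDensity I c) q (chartFrame I c i q)) := by
    intro i f hf hfe
    have hci : MDiffAt (fun y ↦ chartCoord c A y i) q :=
      ((hcoord i).contMDiffAt hs).mdifferentiableAt (by simp)
    have hfd : d% (fun y ↦ chartCoord c A y i) q = d% f q :=
      (Filter.EventuallyEq.mvfderiv_eq hfe).symm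
    have hwρ : MDiffAt (fun y ↦ chartDensity I c y * ρ y) q := hw.mul hρd
    have hall : MDiffAt (fun y ↦ chartDensity I c y * ρ y * chartCoord c A y i) q := hwρ.mul hci
    rw [fderiv_comp_extChartAt_symm hq hall, mvfderiv_fun_mul hwρ hci,
      mvfderiv_fun_mul hw hρd, hfd, ← hfe.self_of_nhds]
    rfl
  rw [Fin.sum_univ_two, hF 0 a ha hae, hF 1 b hb hbe, trace_eq_chartCoeff hq]
  simp only [ContinuousLinearMap.coe_coe, hcov, map_add, map_smul, e0, e1,
    chartCoeff_chartFrame hq, smul_eq_mul, hw0, hw1]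
  rw [hAe.self_of_nhds, Pi.add_apply, Pi.smul_apply', Pi.smul_apply', e0, e1, map_add, map_smul,
    map_smul, hsymm]
  simp only [smul_eq_mul, if_true, Fin.zero_eq_one_iff, one_ne_zero, if_false]
  norm_num
  ring

end LocalDivergence

section ChartExtend

open Filter Topology MeasureTheory

variable {E : Type*} [NormedAddCommGroup E] [NormedSpace ℝ E] [FiniteDimensional ℝ E]
  {H : Type*} [TopologicalSpace H] {I : ModelWithCorners ℝ E H}
  {M : Type*} [TopologicalSpace M] [ChartedSpace H M] [IsManifold I ∞ M]
  {c : M} {F : M → ℝ} {z : E}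

variable (I) in
/-- A function on `M` read in the preferred chart at `c`, extended by zero. -/
noncomputable def chartExtend (c : M) (F : M → ℝ) : E → ℝ :=
  (extChartAt I c).target.indicator (F ∘ (extChartAt I c).symm)

theorem chartExtend_of_mem (hz : z ∈ (extChartAt I c).target) :
    chartExtend I c F z = F ((extChartAt I c).symm z) :=
  Set.indicator_of_mem hz _

theorem chartExtend_of_notMem (hz : z ∉ (extChartAt I c).target) : chartExtend I c F z = 0 :=
  Set.indicator_of_notMem hz _

variable [CompactSpace M]

theorem tsupport_chartExtend_subset (hF : tsupport F ⊆ (extChartAt I c).source) :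
    tsupport (chartExtend I c F) ⊆ extChartAt I c '' tsupport F := by
  have hK : IsCompact (extChartAt I c '' tsupport F) :=
    (isClosed_tsupport F).isCompact.image_of_continuousOn ((continuousOn_extChartAt c).mono hF)
  refine closure_minimal (fun z hz ↦ ?_) hK.isClosed
  have hzt : z ∈ (extChartAt I c).target := by
    by_contra h
    exact hz (chartExtend_of_notMem h)
  refine ⟨(extChartAt I c).symm z, subset_tsupport F ?_, (extChartAt I c).right_inv hzt⟩
  rwa [Function.mem_support, chartExtend_of_mem hzt] at hz

theorem tsupport_chartExtend_subset_target (hF : tsupport F ⊆ (extChartAt I c).source) :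
    tsupport (chartExtend I c F) ⊆ (extChartAt I c).target := by
  refine (tsupport_chartExtend_subset hF).trans ?_
  rintro _ ⟨x, hx, rfl⟩
  exact (extChartAt I c).map_source (hF hx)

theorem hasCompactSupport_chartExtend (hF : tsupport F ⊆ (extChartAt I c).source) :
    HasCompactSupport (chartExtend I c F) :=
  ((isClosed_tsupport F).isCompact.image_of_continuousOn
    ((continuousOn_extChartAt c).mono hF)).of_isClosed_subset (isClosed_tsupport _)
    (tsupport_chartExtend_subset hF)

variable [I.Boundaryless]

theorem chartExtend_eventuallyEq (hz : z ∈ (extChartAt I c).target) :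
    chartExtend I c F =ᶠ[𝓝 z] F ∘ (extChartAt I c).symm :=
  Filter.eventuallyEq_of_mem ((isOpen_extChartAt_target c).mem_nhds hz)
    fun _ h ↦ Set.indicator_of_mem h _

theorem contDiff_chartExtend (hF : tsupport F ⊆ (extChartAt I c).source)
    (hs : CMDiff[(extChartAt I c).source] ∞ F) : ContDiff ℝ ∞ (chartExtend I c F) := by
  refine contMDiff_iff_contDiff.1 (contMDiff_of_tsupport fun z hz ↦ ?_)
  have hzt := tsupport_chartExtend_subset_target hF hz
  have h1 : ContMDiffOn 𝓘(ℝ, E) 𝓘(ℝ, ℝ) ∞ (F ∘ (extChartAt I c).symm) (extChartAt I c).target :=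
    hs.comp (contMDiffOn_extChartAt_symm c) (extChartAt I c).symm.mapsTo
  exact (h1.contMDiffAt ((isOpen_extChartAt_target c).mem_nhds hzt)).congr_of_eventuallyEq
    (chartExtend_eventuallyEq hzt)

variable [MeasurableSpace E] [BorelSpace E] (μ : Measure E) [μ.IsAddHaarMeasure]

theorem integral_fderiv_apply_eq_zero {G : E → ℝ} (hG : ContDiff ℝ ∞ G) (hc : HasCompactSupport G)
    (v : E) : ∫ z, fderiv ℝ G z v ∂μ = 0 := by
  have h1 : Continuous fun z ↦ fderiv ℝ G z v :=
    (hG.continuous_fderiv (by simp)).clm_apply continuous_const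
  have h2 : HasCompactSupport fun z ↦ fderiv ℝ G z v := hc.fderiv_apply ℝ v
  have h := integral_mul_fderiv_eq_neg_fderiv_mul_of_integrable (μ := μ) (f := fun _ ↦ (1 : ℝ))
    (g := G) (v := v) (by simp) (by simpa using h1.integrable_of_hasCompactSupport h2)
    (by simpa using hG.continuous.integrable_of_hasCompactSupport hc)
    (fun x _ ↦ differentiableAt_const _) (fun x _ ↦ (hG.differentiable (by simp)) x)
  simpa using h

end ChartExtend

section ChartIntegral

open Filter Topology MeasureTheory

variable {H : Type*} [TopologicalSpace H] {I : ModelWithCorners ℝ (EuclideanSpace ℝ (Fin 2)) H}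
  {M : Type*} [TopologicalSpace M] [ChartedSpace H M] [IsManifold I ∞ M]
  [RiemannianBundle (fun x : M ↦ TangentSpace I x)]
  [IsContMDiffRiemannianBundle I ∞ (EuclideanSpace ℝ (Fin 2)) (fun x : M ↦ TangentSpace I x)]
  {A : Π x : M, TangentSpace I x} {c c' q : M} {D : LinearConnection I M} {f ρ : M → ℝ}

variable (I) in
/-- The integral with respect to the Riemannian density of a function supported in the domain of
the preferred chart at `c`. -/
noncomputable def chartIntegral (c : M) (f : M → ℝ) : ℝ :=
  ∫ z, chartExtend I c (fun y ↦ chartDensity I c y * f y) z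

variable [CompactSpace M] [I.Boundaryless]

theorem contDiff_chartExtend_density (hf : CMDiff ∞ f) (hs : tsupport f ⊆ (extChartAt I c).source) :
    ContDiff ℝ ∞ (chartExtend I c (fun y ↦ chartDensity I c y * f y)) :=
  contDiff_chartExtend ((tsupport_mul_subset_right).trans hs)
    ((contMDiffOn_chartDensity c).mul hf.contMDiffOn)

theorem integrable_chartExtend_density (hf : CMDiff ∞ f)
    (hs : tsupport f ⊆ (extChartAt I c).source) :
    Integrable (chartExtend I c (fun y ↦ chartDensity I c y * f y)) :=
  (contDiff_chartExtend_density hf hs).continuous.integrable_of_hasCompactSupport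
    (hasCompactSupport_chartExtend ((tsupport_mul_subset_right).trans hs))

theorem chartIntegral_sum {ι : Type*} (s : Finset ι) {f : ι → M → ℝ} (hf : ∀ i, CMDiff ∞ (f i))
    (hs : ∀ i, tsupport (f i) ⊆ (extChartAt I c).source) :
    chartIntegral I c (fun y ↦ ∑ i ∈ s, f i y) = ∑ i ∈ s, chartIntegral I c (f i) := by
  unfold chartIntegral
  rw [← integral_finsetSum _ fun i _ ↦ integrable_chartExtend_density (hf i) (hs i)]
  congr 1
  ext z
  by_cases hz : z ∈ (extChartAt I c).target
  · simp only [chartExtend_of_mem hz, Finset.mul_sum]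
  · simp only [chartExtend_of_notMem hz, Finset.sum_const_zero]

theorem chartIntegral_const_mul (r : ℝ) :
    chartIntegral I c (fun y ↦ r * f y) = r * chartIntegral I c f := by
  unfold chartIntegral
  rw [← integral_const_mul]
  congr 1
  ext z
  by_cases hz : z ∈ (extChartAt I c).target
  · simp only [chartExtend_of_mem hz]
    ring
  · simp only [chartExtend_of_notMem hz, mul_zero]

theorem chartExtend_density_nonneg (hf : ∀ y, 0 ≤ f y) :
    0 ≤ chartExtend I c (fun y ↦ chartDensity I c y * f y) := fun z ↦
  Set.indicator_nonneg (fun _ _ ↦ mul_nonneg (Real.sqrt_nonneg _) (hf _)) z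

theorem chartIntegral_nonneg (hf : ∀ y, 0 ≤ f y) : 0 ≤ chartIntegral I c f :=
  integral_nonneg (chartExtend_density_nonneg hf)

theorem chartIntegral_pos (hf : CMDiff ∞ f) (hs : tsupport f ⊆ (extChartAt I c).source)
    (h0 : ∀ y, 0 ≤ f y) (hq : f q ≠ 0) : 0 < chartIntegral I c f := by
  have hqs : q ∈ (extChartAt I c).source := hs (subset_tsupport f hq)
  refine (contDiff_chartExtend_density hf
    hs).continuous.integral_pos_of_hasCompactSupport_nonneg_nonzero (x := extChartAt I c q)
    (hasCompactSupport_chartExtend ((tsupport_mul_subset_right).trans hs))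
    (chartExtend_density_nonneg h0) ?_
  rw [chartExtend_of_mem ((extChartAt I c).map_source hqs), (extChartAt I c).left_inv hqs]
  exact mul_ne_zero (Real.sqrt_pos.2 (chartGram_pos hqs)).ne' hq

variable [T2Space M]

theorem chartIntegral_divergence (hD : D.IsLeviCivita) (hA : CMDiff ∞ (T% A)) (hρ : CMDiff ∞ ρ)
    (hs : tsupport ρ ⊆ (extChartAt I c).source) :
    chartIntegral I c
      (fun q ↦ d% ρ q (A q) + ρ q * LinearMap.trace ℝ _ (D.cov A q).toLinearMap) = 0 := by
  let F : Fin 2 → M → ℝ := fun i y ↦ chartDensity I c y * ρ y * chartCoord c A y i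
  have hcoord : ∀ i, CMDiff[(extChartAt I c).source] ∞ (fun y ↦ chartCoord c A y i) := fun i ↦
    (EuclideanSpace.proj (𝕜 := ℝ) i : EuclideanSpace ℝ (Fin 2) →L[ℝ] ℝ).contMDiff.comp_contMDiffOn
      (contMDiffOn_chartCoord hA c)
  have hFs : ∀ i, tsupport (F i) ⊆ (extChartAt I c).source := fun i ↦
    tsupport_mul_subset_left.trans (tsupport_mul_subset_right.trans hs)
  have hF : ∀ i, CMDiff[(extChartAt I c).source] ∞ (F i) := fun i ↦
    ((contMDiffOn_chartDensity c).mul hρ.contMDiffOn).mul (hcoord i)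
  have hG := fun i ↦ contDiff_chartExtend (hFs i) (hF i)
  have hGc := fun i ↦ hasCompactSupport_chartExtend (I := I) (hFs i)
  have hint : ∀ i, Integrable fun z ↦ fderiv ℝ (chartExtend I c (F i)) z (EuclideanSpace.single i 1) :=
    fun i ↦ (((hG i).continuous_fderiv (by simp)).clm_apply
      continuous_const).integrable_of_hasCompactSupport ((hGc i).fderiv_apply ℝ _)
  have key : chartIntegral I c
      (fun q ↦ d% ρ q (A q) + ρ q * LinearMap.trace ℝ _ (D.cov A q).toLinearMap) =
      ∫ z, ∑ i, fderiv ℝ (chartExtend I c (F i)) z (EuclideanSpace.single i 1) := by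
    unfold chartIntegral
    congr 1
    ext z
    by_cases hz : z ∈ (extChartAt I c).target
    · have hq := (extChartAt I c).map_target hz
      have h := chart_divergence (I := I) hD hA hq hρ
      rw [(extChartAt I c).right_inv hz] at h
      rw [chartExtend_of_mem hz, ← h]
      refine Finset.sum_congr rfl fun i _ ↦ ?_
      rw [(chartExtend_eventuallyEq hz).fderiv_eq]
    · rw [chartExtend_of_notMem hz]
      symm
      refine Finset.sum_eq_zero fun i _ ↦ ?_
      have h0 : fderiv ℝ (chartExtend I c (F i)) z = 0 := by
        by_contra h
        exact hz (tsupport_chartExtend_subset_target (hFs i) (support_fderiv_subset ℝ h))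
      rw [h0]
      rfl
  rw [key, integral_finsetSum _ fun i _ ↦ hint i]
  exact Finset.sum_eq_zero fun i _ ↦ integral_fderiv_apply_eq_zero volume (hG i) (hGc i) _

theorem chartIntegral_eq_chartIntegral (h : ∀ y, f y ≠ 0 → y ∈ (extChartAt I c).source)
    (h' : ∀ y, f y ≠ 0 → y ∈ (extChartAt I c').source) :
    chartIntegral I c f = chartIntegral I c' f := by
  have aux : ∀ {a b : M}, (∀ y, f y ≠ 0 → y ∈ (extChartAt I b).source) →
      chartIntegral I a f = ∫ z in (extChartAt I a).target ∩
        (extChartAt I a).symm ⁻¹' (extChartAt I b).source,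
          chartDensity I a ((extChartAt I a).symm z) * f ((extChartAt I a).symm z) := by
    intro a b hb
    have hm : MeasurableSet (extChartAt I a).target := (isOpen_extChartAt_target a).measurableSet
    rw [chartIntegral, chartExtend, integral_indicator hm]
    apply setIntegral_eq_of_subset_of_forall_sdiff_eq_zero hm Set.inter_subset_left
    intro z hz
    have : f ((extChartAt I a).symm z) = 0 := by
      by_contra hne
      exact hz.2 ⟨hz.1, hb _ hne⟩
    rw [Function.comp_apply, this, mul_zero]
  rw [aux (b := c') h', aux (b := c) h]
  set φ := extChartAt I c' ∘ (extChartAt I c).symm with hφ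
  set s := (extChartAt I c).target ∩ (extChartAt I c).symm ⁻¹' (extChartAt I c').source with hs
  have hso : IsOpen s := (continuousOn_extChartAt_symm c).isOpen_inter_preimage
    (isOpen_extChartAt_target c) (isOpen_extChartAt_source c')
  have himg : φ '' s = (extChartAt I c').target ∩
      (extChartAt I c').symm ⁻¹' (extChartAt I c).source := by
    ext w
    constructor
    · rintro ⟨z, hz, rfl⟩
      refine ⟨(extChartAt I c').map_source hz.2, ?_⟩
      simp only [Set.mem_preimage, hφ, Function.comp_apply]
      rw [(extChartAt I c').left_inv hz.2]
      exact (extChartAt I c).map_target hz.1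
    · intro hw
      refine ⟨extChartAt I c ((extChartAt I c').symm w), ⟨(extChartAt I c).map_source hw.2, ?_⟩, ?_⟩
      · simp only [Set.mem_preimage]
        rw [(extChartAt I c).left_inv hw.2]
        exact (extChartAt I c').map_target hw.1
      · rw [hφ, Function.comp_apply, (extChartAt I c).left_inv hw.2,
          (extChartAt I c').right_inv hw.1]
  have hinj : Set.InjOn φ s := by
    intro z hz w hw hzw
    have h1 := (extChartAt I c').injOn hz.2 hw.2 hzw
    exact (extChartAt I c).symm.injOn hz.1 hw.1 h1
  have hd : ∀ z ∈ s, HasFDerivWithinAt φ (fderiv ℝ φ z) s z := by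
    intro z hz
    have h1 : ContMDiffOn 𝓘(ℝ, EuclideanSpace ℝ (Fin 2)) 𝓘(ℝ, EuclideanSpace ℝ (Fin 2)) ∞ φ s :=
      (contMDiffOn_extChartAt (n := ∞)).comp ((contMDiffOn_extChartAt_symm c).mono
        Set.inter_subset_left) (by
          intro w hw
          have := hw.2
          rwa [Set.mem_preimage, extChartAt_source] at this)
    exact (((contMDiffAt_iff_contDiffAt.1 (h1.contMDiffAt (hso.mem_nhds hz))).differentiableAt
      (by simp)).hasFDerivAt).hasFDerivWithinAt
  rw [← himg, integral_image_eq_integral_abs_det_fderiv_smul volume hso.measurableSet hd hinj]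
  refine setIntegral_congr_fun hso.measurableSet fun z hz ↦ ?_
  have hq := (extChartAt I c).map_target hz.1
  have h1 := chartDensity_eq_abs_det_mul (I := I) hq hz.2
  rw [(extChartAt I c).right_inv hz.1] at h1
  simp only [hφ, Function.comp_apply, (extChartAt I c').left_inv hz.2, smul_eq_mul]
  rw [h1]
  simp only [Function.comp_def]
  ring

end ChartIntegral

section ClosedSurface

open Filter Topology

variable {H : Type*} [TopologicalSpace H] {I : ModelWithCorners ℝ (EuclideanSpace ℝ (Fin 2)) H}
  {M : Type*} [TopologicalSpace M] [ChartedSpace H M] [IsManifold I ∞ M] [T2Space M]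
  [RiemannianBundle (fun x : M ↦ TangentSpace I x)]
  [IsContMDiffRiemannianBundle I ∞ (EuclideanSpace ℝ (Fin 2)) (fun x : M ↦ TangentSpace I x)]
  {A ξ : Π x : M, TangentSpace I x} {q : M} {D : LinearConnection I M} {κ : ℝ}

theorem tsupport_lieDerivative_subset {ρ : M → ℝ} :
    tsupport (fun y ↦ d% ρ y (A y)) ⊆ tsupport ρ := by
  refine closure_minimal (fun y hy ↦ ?_) (isClosed_tsupport ρ)
  by_contra h
  apply hy
  have h0 : ρ =ᶠ[𝓝 y] fun _ ↦ 0 := notMem_tsupport_iff_eventuallyEq.1 h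
  simp only [h0.mvfderiv_eq, mvfderiv_const]
  rfl

theorem lieDerivative_sum {ι : Type*} (s : Finset ι) {f : ι → M → ℝ} (hf : ∀ i, CMDiff ∞ (f i))
    (v : TangentSpace I q) : d% (fun y ↦ ∑ i ∈ s, f i y) q v = ∑ i ∈ s, d% (f i) q v := by
  classical
  induction s using Finset.induction_on with
  | empty =>
    simp only [Finset.sum_empty, mvfderiv_const]
    rfl
  | insert a s ha ih =>
    simp only [Finset.sum_insert ha]
    have hs : CMDiff ∞ (fun y ↦ ∑ i ∈ s, f i y) := contMDiff_finsetSum fun i _ ↦ hf i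
    rw [mvfderiv_fun_add (hf a).mdiffAt_fun hs.mdiffAt_fun, add_apply, ih]

/-- On a closed surface no vector field has constant positive divergence. -/
theorem not_trace_cov_eq_const [CompactSpace M] [Nonempty M] [I.Boundaryless]
    (hD : D.IsLeviCivita) (hA : CMDiff ∞ (T% A)) (hκ : 0 < κ) :
    ¬ ∀ q, LinearMap.trace ℝ _ (D.cov A q).toLinearMap = κ := by
  intro htr
  obtain ⟨t, ht⟩ := CompactSpace.elim_nhds_subcover (fun x : M ↦ (extChartAt I x).source)
    fun x ↦ extChartAt_source_mem_nhds x
  obtain ⟨ρ, hρ⟩ := SmoothPartitionOfUnity.exists_isSubordinate I isClosed_univ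
    (fun i : t ↦ (extChartAt I (i : M)).source) (fun i ↦ isOpen_extChartAt_source _) (by
      intro x _
      have hx : x ∈ ⋃ x ∈ t, (extChartAt I x).source := by rw [ht]; trivial
      simpa using hx)
  have hsum : ∀ x, ∑ i, ρ i x = 1 := fun x ↦ by
    rw [← finsum_eq_sum_of_fintype]
    exact ρ.sum_eq_one (Set.mem_univ x)
  have hsm : ∀ i, CMDiff ∞ (ρ i) := fun i ↦ (ρ i).contMDiff
  have hdsm : ∀ i, CMDiff ∞ (fun y ↦ d% (ρ i) y (A y)) := fun i ↦ contMDiff_lieDerivative (hsm i) hA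
  have hds : ∀ i, tsupport (fun y ↦ d% (ρ i) y (A y)) ⊆ (extChartAt I (i : M)).source := fun i ↦
    tsupport_lieDerivative_subset.trans (hρ i)
  have hlocal : ∀ i : t, chartIntegral I (i : M) (fun y ↦ d% (ρ i) y (A y)) =
      -(κ * chartIntegral I (i : M) (ρ i)) := by
    intro i
    have h := chartIntegral_divergence hD hA (hsm i) (hρ i)
    have h2 := chartIntegral_sum (I := I) (c := (i : M)) Finset.univ
      (f := ![fun y ↦ d% (ρ i) y (A y), fun y ↦ κ * ρ i y]) (by
        intro j
        fin_cases j
        · exact hdsm i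
        · exact contMDiff_const.mul (hsm i)) (by
        intro j
        fin_cases j
        · exact hds i
        · exact tsupport_mul_subset_right.trans (hρ i))
    simp only [Fin.sum_univ_two, Matrix.cons_val_zero, Matrix.cons_val_one] at h2
    rw [chartIntegral_const_mul] at h2
    simp only [htr, mul_comm _ κ] at h
    rw [h2] at h
    linarith
  have htotal : ∑ i : t, chartIntegral I (i : M) (fun y ↦ d% (ρ i) y (A y)) = 0 := by
    have hsm2 : ∀ i j, CMDiff ∞ (fun y ↦ ρ j y * d% (ρ i) y (A y)) := fun i j ↦
      (hsm j).mul (hdsm i)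
    have h1 : ∀ i : t, chartIntegral I (i : M) (fun y ↦ d% (ρ i) y (A y)) =
        ∑ j : t, chartIntegral I (j : M) (fun y ↦ ρ j y * d% (ρ i) y (A y)) := by
      intro i
      have h2 : (fun y ↦ d% (ρ i) y (A y)) = fun y ↦ ∑ j, ρ j y * d% (ρ i) y (A y) := by
        ext y
        rw [← Finset.sum_mul, hsum, one_mul]
      conv_lhs => rw [h2]
      rw [chartIntegral_sum Finset.univ (fun j ↦ hsm2 i j)
        fun j ↦ tsupport_mul_subset_right.trans (hds i)]
      refine Finset.sum_congr rfl fun j _ ↦ chartIntegral_eq_chartIntegral (fun y hy ↦ ?_)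
        fun y hy ↦ ?_
      · exact hds i (subset_tsupport _ (right_ne_zero_of_mul hy))
      · exact hρ j (subset_tsupport _ (left_ne_zero_of_mul hy))
    rw [Finset.sum_congr rfl fun i _ ↦ h1 i, Finset.sum_comm]
    refine Finset.sum_eq_zero fun j _ ↦ ?_
    rw [← chartIntegral_sum Finset.univ (fun i ↦ hsm2 i j)
      fun i ↦ tsupport_mul_subset_left.trans (hρ j)]
    have h3 : (fun y ↦ ∑ i, ρ j y * d% (ρ i) y (A y)) = fun y ↦ (0 : ℝ) * ρ j y := by
      ext y
      have h4 : d% (fun y ↦ ∑ i, ρ i y) y (A y) = 0 := by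
        simp only [hsum, mvfderiv_const]
        rfl
      rw [← Finset.mul_sum, zero_mul, ← lieDerivative_sum Finset.univ hsm, h4, mul_zero]
    rw [h3, chartIntegral_const_mul, zero_mul]
  obtain ⟨x⟩ := ‹Nonempty M›
  obtain ⟨i, hi⟩ := ρ.exists_pos_of_mem (Set.mem_univ x)
  have hpos : 0 < ∑ i : t, chartIntegral I (i : M) (ρ i) :=
    Finset.sum_pos' (fun j _ ↦ chartIntegral_nonneg (ρ.nonneg j))
      ⟨i, Finset.mem_univ i, chartIntegral_pos (hsm i) (hρ i) (ρ.nonneg i) hi.ne'⟩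
  simp only [hlocal, Finset.sum_neg_distrib, ← Finset.mul_sum] at htotal
  have := mul_pos hκ hpos
  linarith

theorem trace_cov_umbilicNormal (hD : D.IsLeviCivita)
    (hκ : ∀ X Y : Π x : M, TangentSpace I x, CMDiff ∞ (T% X) → CMDiff ∞ (T% Y) →
      ∀ x : M, LinearIndependent ℝ ![X x, Y x] → D.sectionalCurvature X Y x = κ)
    (hA : CMDiff ∞ (T% A)) (hξ : CMDiff ∞ (T% ξ))
    (h : ∀ᶠ y in 𝓝 q, IsUmbilicNormalAt D A ξ y) :
    LinearMap.trace ℝ _ (D.cov A q).toLinearMap = κ := by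
  have hq := h.self_of_nhds
  obtain ⟨v, hv0, hv⟩ := exists_ne_zero_inner_eq_zero (I := I) (by simp) (ξ q)
  obtain ⟨e, he, hee⟩ : ∃ e : TangentSpace I q, (inner ℝ e (ξ q) : ℝ) = 0 ∧ (inner ℝ e e : ℝ) = 1 := by
    refine ⟨‖v‖⁻¹ • v, by rw [real_inner_smul_left, hv, mul_zero], ?_⟩
    rw [real_inner_self_eq_norm_sq, norm_smul, norm_inv, norm_norm,
      inv_mul_cancel₀ (norm_ne_zero_iff.2 hv0), one_pow]
  have hon : Orthonormal ℝ ![ξ q, e] := by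
    rw [orthonormal_iff_ite]
    intro i j
    fin_cases i <;> fin_cases j
    · exact hq.inner_self
    · exact (real_inner_comm _ _).trans he
    · exact he
    · exact hee
  have hspan : ⊤ ≤ Submodule.span ℝ (Set.range ![ξ q, e]) := by
    rw [hon.linearIndependent.span_eq_top_of_card_eq_finrank]
    change Fintype.card (Fin 2) = Module.finrank ℝ (EuclideanSpace ℝ (Fin 2))
    simp
  let b := OrthonormalBasis.mk hon hspan
  rw [LinearMap.trace_eq_sum_inner _ b, Fin.sum_univ_two]
  have hb0 : b 0 = ξ q := by simp [b]
  have hb1 : b 1 = e := by simp [b]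
  have hR := inner_cov_umbilicNormal hD hκ hA hξ h he
  have hL := hq.lieDerivative_inner hD hA hξ (ξ q)
  have hAA := b.sum_inner_mul_inner (A q) (A q)
  rw [Fin.sum_univ_two] at hAA
  rw [hb0, hb1] at hAA ⊢
  rw [hL, hee, hq.inner_self] at hR
  simp only [ContinuousLinearMap.coe_coe]
  rw [real_inner_comm _ (ξ q), real_inner_comm _ e, hR, ← hAA, real_inner_comm (A q) (ξ q),
    real_inner_comm (A q) e]
  ring

end ClosedSurface

theorem mainTheorem3 (n : ℕ) (hn : 2 ≤ n)
    (M : Type*) [TopologicalSpace M] [T2Space M] [CompactSpace M] [Nonempty M]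
    [ChartedSpace (EuclideanSpace ℝ (Fin n)) M] [IsManifold (𝓡 n) ∞ M]
    [RiemannianBundle (fun x : M ↦ TangentSpace (𝓡 n) x)]
    [IsContMDiffRiemannianBundle (𝓡 n) ∞ (EuclideanSpace ℝ (Fin n))
      (fun x : M ↦ TangentSpace (𝓡 n) x)]
    (κ : ℝ) (hκ : 0 < κ) (hM : HasConstantSectionalCurvature (𝓡 n) M κ) :
    ¬ ∃ P : ConformalProductStructure (𝓡 n) M, P.rank = 1 := by
  rintro ⟨P, hP⟩
  obtain ⟨D, hD, hsec⟩ := hM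
  obtain ⟨T, hT, hTP⟩ : ∃ T : SmoothDistribution (𝓡 n) M, T.rank = 1 ∧
      T.IsParallel P.toLinearConnection := by
    rcases min_choice P.T₁.rank P.T₂.rank with h | h
    · exact ⟨P.T₁, h.symm.trans hP, P.parallel₁⟩
    · exact ⟨P.T₂, h.symm.trans hP, P.parallel₂⟩
  obtain ⟨A, hA, h⟩ := P.toWeylConnection.exists_umbilicNormal hD T hT hTP
  rcases hn.eq_or_lt with rfl | hn
  · refine not_trace_cov_eq_const hD hA hκ fun q ↦ ?_
    obtain ⟨ξ, hξ, hq⟩ := h q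
    exact trace_cov_umbilicNormal hD hsec hA hξ (hq.mono fun _ hy ↦ hy.1)
  · exact not_umbilicNormal_of_three_le_finrank hκ hD hsec
      (by rw [finrank_euclideanSpace_fin]; exact hn) hA h
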